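/- Let $\tau$ be a formal parameter. Let $U_\tau(so(2,2))$ be the $\tau$-adically complete unital $\mathbb R[[\tau]]$-algebra topologically generated by $H,P,K,D,C_1,C_2$ with the relations $$[K,H]=e^{-\tau H}P,\quad [K,P]=\tfrac{e^{\tau H}-1}{\tau},\quad [H,P]=0,\quad [D,H]=\tfrac{1-e^{-\tau H}}{\tau},\quad [D,C_1]=-C_1+\tau D^2,\quad [H,C_1]=-2D,$$ $$[D,P]=P,\quad [D,C_2]=-C_2,\quad [P,C_2]=2D,\quad [K,C_1]=C_2,\quad [K,C_2]=C_1-\tau D^2,\quad [C_1,C_2]=-\tau(DC_2+C_2D),$$ $$[H,C_2]=e^{-\tau H}K+Ke^{-\tau H},\quad [P,C_1]=-2K-\tau(DP+PD),\quad [K,D]=0,$$ and let $U_\tau(sl(2,\mathbb R))$ be the $\tau$-adically complete unital $\mathbb R[[\tau]]$-algebra topologically generated by $D,H,C_1$ with those of these relations that involve only $D,H,C_1$. Completed tensor products over $\mathbb R[[\tau]]$ are written $\otimes$. For a continuous algebra homomorphism $\Delta:U\to U\otimes U$ with opposite $\Delta^{op}$, an invertible $\mathcal R\in U\otimes U$ is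 called a universal R-matrix for $(U,\Delta)$ if $$\mathcal R\,\Delta(x)=\Delta^{op}(x)\,\mathcal R\ \ (x\in U),\qquad (\Delta\otimes\mathrm{id})\mathcal R=\mathcal R_{13}\mathcal R_{23},\qquad (\mathrm{id}\otimes\Delta)\mathcal R=\mathcal R_{13}\mathcal R_{12}.$$ There is a continuous $\mathbb R[[\tau]]$-algebra homomorphism $\Delta$ on $U_\tau(so(2,2))$ with $$\Delta(H)=1\otimes H+H\otimes 1,\quad \Delta(P)=1\otimes P+P\otimes e^{\tau H},\quad \Delta(D)=1\otimes D+D\otimes e^{-\tau H},\quad \Delta(C_1)=1\otimes C_1+C_1\otimes e^{-\tau H},$$ $$\Delta(K)=1\otimes K+K\otimes 1-\tau D\otimes e^{-\tau H}P,$$ $$\Delta(C_2)=1\otimes C_2+C_2\otimes e^{-\tau H}+2\tau D\otimes e^{-\tau H}K-\tau^2D(D+1)\otimes e^{-2\tau H}P,$$ and a continuous homomorphism $\varepsilon$ to $\mathbb R[[\tau]]$ such that $\Delta$ is coassociative with counit $\varepsilon$. In the same way the formulas for $\Delta(H),\Delta(D),\Delta(C_1)$ define a coassociative counital coproduct on $U_\tau(sl(2,\mathbb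 R))$, and there is a continuous homomorphism $U_\tau(sl(2,\mathbb R))\to U_\tau(so(2,2))$ which sends $D,H,C_1$ to $D,H,C_1$ and respects coproducts and counits. The element $$\mathcal R=\exp\{\tau H\otimes D\}\,\exp\{-\tau D\otimes H\}$$ of $U_\tau(sl(2,\mathbb R))\otimes U_\tau(sl(2,\mathbb R))$ is a universal R-matrix for $U_\tau(sl(2,\mathbb R))$; the homomorphism above carries it to the element of $U_\tau(so(2,2))\otimes U_\tau(so(2,2))$ given by the same formula; and that element is a universal R-matrix for the whole $U_\tau(so(2,2))$. -/

import Mathlib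

open scoped TensorProduct PowerSeries Nat

noncomputable section

namespace QuantumSO

/-- The formal deformation parameter `τ ∈ ℝ⟦τ⟧`. -/
abbrev τ : ℝ⟦X⟧ := PowerSeries.X

/-! ### Exponentials modulo `τ ^ n` -/

section Exp

variable {A B : Type*} [Semiring A] [Algebra ℝ⟦X⟧ A] [Semiring B] [Algebra ℝ⟦X⟧ B]

/-- `e^{τ a}` modulo `τ ^ n`, i.e. `∑_{i < n} (τ ^ i / i!) a ^ i`. -/
def expTrunc (n : ℕ) (a : A) : A :=
  ∑ i ∈ Finset.range n, PowerSeries.monomial (R := ℝ) i ((i ! : ℝ)⁻¹) • a ^ i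

/-- `(e^{τ a} - 1) / τ` modulo `τ ^ n`, i.e. `∑_{i < n} (τ ^ i / (i + 1)!) a ^ (i + 1)`. -/
def expSubOneDivTrunc (n : ℕ) (a : A) : A :=
  ∑ i ∈ Finset.range n, PowerSeries.monomial (R := ℝ) i (((i + 1)! : ℝ)⁻¹) • a ^ (i + 1)

lemma map_expTrunc (f : A →ₐ[ℝ⟦X⟧] B) (n : ℕ) (a : A) :
    f (expTrunc n a) = expTrunc n (f a) := by
  simp [expTrunc]

lemma map_expSubOneDivTrunc (f : A →ₐ[ℝ⟦X⟧] B) (n : ℕ) (a : A) :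
    f (expSubOneDivTrunc n a) = expSubOneDivTrunc n (f a) := by
  simp [expSubOneDivTrunc]

lemma monomial_smul_eq_zero {n : ℕ} (h : algebraMap ℝ⟦X⟧ A (τ ^ n) = 0) (r : ℝ) (a : A) :
    PowerSeries.monomial (R := ℝ) n r • a = 0 := by
  have hm : PowerSeries.monomial (R := ℝ) n r = PowerSeries.C r * τ ^ n := by
    ext m
    simp [PowerSeries.coeff_monomial, PowerSeries.coeff_X_pow]
  rw [hm, Algebra.smul_def, map_mul, h, mul_zero, zero_mul]

lemma expTrunc_succ {n : ℕ} (h : algebraMap ℝ⟦X⟧ A (τ ^ n) = 0) (a : A) :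
    expTrunc (n + 1) a = expTrunc n a := by
  rw [expTrunc, Finset.sum_range_succ, monomial_smul_eq_zero h, add_zero, expTrunc]

lemma expSubOneDivTrunc_succ {n : ℕ} (h : algebraMap ℝ⟦X⟧ A (τ ^ n) = 0) (a : A) :
    expSubOneDivTrunc (n + 1) a = expSubOneDivTrunc n a := by
  rw [expSubOneDivTrunc, Finset.sum_range_succ, monomial_smul_eq_zero h, add_zero,
    expSubOneDivTrunc]

end Exp

/-! ### `τ`-adically complete algebras as inverse limits of their reductions modulo `τ ^ n` -/

/-- An inverse system of `ℝ⟦τ⟧`-algebras whose `n`-th member is killed by `τ ^ n`. -/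
structure Tower where
  obj : ℕ → Type
  [ring : ∀ n, Ring (obj n)]
  [algebra : ∀ n, Algebra ℝ⟦X⟧ (obj n)]
  proj : ∀ n, obj (n + 1) →ₐ[ℝ⟦X⟧] obj n
  tau_pow : ∀ n, algebraMap ℝ⟦X⟧ (obj n) (τ ^ n) = 0

attribute [instance] Tower.ring Tower.algebra

namespace Tower

/-- The inverse limit of the system: the complete algebra that the system describes. -/
def limit (T : Tower) : Subalgebra ℝ⟦X⟧ (∀ n, T.obj n) where
  carrier := {x | ∀ n, T.proj n (x (n + 1)) = x n}
  mul_mem' hx hy n := by simp [hx n, hy n]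
  add_mem' hx hy n := by simp [hx n, hy n]
  algebraMap_mem' _ _ := by simp

/-- The element `e^{τ a}` of the complete algebra. -/
def expTau (T : Tower) (a : T.limit) : T.limit :=
  ⟨fun n => expTrunc n (a.1 n), fun n => by
    rw [map_expTrunc, a.2 n, expTrunc_succ (T.tau_pow n)]⟩

/-- The completed tensor product over `ℝ⟦τ⟧`: its reduction modulo `τ ^ n` is the tensor product of
the reductions modulo `τ ^ n`, so the complete algebra `S ⊗̂ T` is `(S.tensor T).limit`. -/
abbrev tensor (S T : Tower) : Tower where
  obj n := S.obj n ⊗[ℝ⟦X⟧] T.obj n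
  proj n := Algebra.TensorProduct.map (S.proj n) (T.proj n)
  tau_pow n := by
    rw [Algebra.TensorProduct.algebraMap_apply, S.tau_pow, TensorProduct.zero_tmul]

/-- The pure tensor `a ⊗ b` in the completed tensor product. -/
def tmul {S T : Tower} (a : S.limit) (b : T.limit) : (S.tensor T).limit :=
  ⟨fun n => a.1 n ⊗ₜ[ℝ⟦X⟧] b.1 n, fun n => by
    change Algebra.TensorProduct.map (S.proj n) (T.proj n) _ = _
    rw [Algebra.TensorProduct.map_tmul, a.2 n, b.2 n]⟩

/-- The ground ring `ℝ⟦τ⟧`, as the inverse limit of the `ℝ⟦τ⟧ / (τ ^ n)`. -/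
abbrev ground : Tower where
  obj n := ℝ⟦X⟧ ⧸ Ideal.span {τ ^ n}
  proj n := Ideal.Quotient.factorₐ ℝ⟦X⟧
    (Ideal.span_singleton_le_span_singleton.2 (pow_dvd_pow τ n.le_succ))
  tau_pow n := Ideal.Quotient.eq_zero_iff_mem.2 (Ideal.mem_span_singleton_self _)

/-- A continuous homomorphism of complete algebras, given by its reductions modulo `τ ^ n`. -/
structure Hom (S T : Tower) where
  app : ∀ n, S.obj n →ₐ[ℝ⟦X⟧] T.obj n
  comm : ∀ n, (T.proj n).comp (app (n + 1)) = (app n).comp (S.proj n)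

namespace Hom

variable {S T S' T' W : Tower}

/-- The homomorphism between the complete algebras. -/
def lim (f : Hom S T) : S.limit →ₐ[ℝ⟦X⟧] T.limit where
  toFun x := ⟨fun n => f.app n (x.1 n), fun n => by
    rw [← AlgHom.comp_apply, f.comm, AlgHom.comp_apply, x.2 n]⟩
  map_one' := by ext n; simp
  map_mul' x y := by ext n; simp
  map_zero' := by ext n; simp
  map_add' x y := by ext n; simp
  commutes' r := by ext n; simp

/-- The identity. -/
def id (T : Tower) : Hom T T := ⟨fun n => AlgHom.id _ _, fun n => by ext; rfl⟩

/-- Composition. -/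
def comp (g : Hom T W) (f : Hom S T) : Hom S W :=
  ⟨fun n => (g.app n).comp (f.app n), fun n => by
    rw [← AlgHom.comp_assoc, g.comm, AlgHom.comp_assoc, f.comm, AlgHom.comp_assoc]⟩

/-- The completed tensor product `f ⊗̂ g` of two homomorphisms. -/
def tensor (f : Hom S S') (g : Hom T T') : Hom (S.tensor T) (S'.tensor T') :=
  ⟨fun n => Algebra.TensorProduct.map (f.app n) (g.app n), fun n => by
    change (Algebra.TensorProduct.map (S'.proj n) (T'.proj n)).comp _ =
      AlgHom.comp _ (Algebra.TensorProduct.map (S.proj n) (T.proj n))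
    rw [← Algebra.TensorProduct.map_comp, ← Algebra.TensorProduct.map_comp, f.comm, g.comm]⟩

/-- The flip `a ⊗ b ↦ b ⊗ a`. -/
def swap (S T : Tower) : Hom (S.tensor T) (T.tensor S) :=
  ⟨fun n => (Algebra.TensorProduct.comm ℝ⟦X⟧ (S.obj n) (T.obj n)).toAlgHom, fun n => by
    ext <;> simp⟩

/-- The associator `(a ⊗ b) ⊗ c ↦ a ⊗ (b ⊗ c)`. -/
def assoc (S T W : Tower) : Hom ((S.tensor T).tensor W) (S.tensor (T.tensor W)) :=
  ⟨fun n => (Algebra.TensorProduct.assoc ℝ⟦X⟧ ℝ⟦X⟧ ℝ⟦X⟧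
      (S.obj n) (T.obj n) (W.obj n)).toAlgHom, fun n => by
    ext <;> simp [Algebra.TensorProduct.one_def]⟩

/-- The inclusion `a ↦ a ⊗ 1`. -/
def inl (S T : Tower) : Hom S (S.tensor T) :=
  ⟨fun n => Algebra.TensorProduct.includeLeft, fun n => by ext; simp⟩

/-- The inclusion `b ↦ 1 ⊗ b`. -/
def inr (S T : Tower) : Hom T (S.tensor T) :=
  ⟨fun n => Algebra.TensorProduct.includeRight, fun n => by ext; simp⟩

end Hom

variable (T : Tower)

/-- `a ⊗ b ↦ a ⊗ b ⊗ 1`. -/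
def leg₁₂ : Hom (T.tensor T) (T.tensor (T.tensor T)) :=
  (Hom.assoc T T T).comp (Hom.inl (T.tensor T) T)

/-- `a ⊗ b ↦ a ⊗ 1 ⊗ b`. -/
def leg₁₃ : Hom (T.tensor T) (T.tensor (T.tensor T)) :=
  (Hom.id T).tensor (Hom.inr T T)

/-- `a ⊗ b ↦ 1 ⊗ a ⊗ b`. -/
def leg₂₃ : Hom (T.tensor T) (T.tensor (T.tensor T)) :=
  Hom.inr T (T.tensor T)

variable {T}

/-- `Δ ⊗ id : T ⊗̂ T → T ⊗̂ T ⊗̂ T`. -/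
def comulLeft (Δ : Hom T (T.tensor T)) : Hom (T.tensor T) (T.tensor (T.tensor T)) :=
  (Hom.assoc T T T).comp (Δ.tensor (Hom.id T))

/-- `id ⊗ Δ : T ⊗̂ T → T ⊗̂ T ⊗̂ T`. -/
def comulRight (Δ : Hom T (T.tensor T)) : Hom (T.tensor T) (T.tensor (T.tensor T)) :=
  (Hom.id T).tensor Δ

/-- `Δ` and `ε` are the coproduct and the counit of a (topological) bialgebra. -/
structure IsBialgebra (Δ : Hom T (T.tensor T)) (ε : Hom T ground) : Prop where
  coassoc : ∀ x : T.limit, (comulLeft Δ).lim (Δ.lim x) = (comulRight Δ).lim (Δ.lim x)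
  counit_left : ∀ x : T.limit, (ε.tensor (Hom.id T)).lim (Δ.lim x) = tmul 1 x
  counit_right : ∀ x : T.limit, ((Hom.id T).tensor ε).lim (Δ.lim x) = tmul x 1

/-- `R` is a universal R-matrix for the coproduct `Δ`. -/
structure IsUniversalRMatrix (Δ : Hom T (T.tensor T)) (R : (T.tensor T).limit) : Prop where
  isUnit : IsUnit R
  intertwines : ∀ x : T.limit, R * Δ.lim x = (Hom.swap T T).lim (Δ.lim x) * R
  hexagon_left : (comulLeft Δ).lim R = (leg₁₃ T).lim R * (leg₂₃ T).lim R
  hexagon_right : (comulRight Δ).lim R = (leg₁₃ T).lim R * (leg₁₂ T).lim R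

/-- `exp{τ H ⊗ D} exp{-τ D ⊗ H}`. -/
def rMatrix (H D : T.limit) : (T.tensor T).limit :=
  (T.tensor T).expTau (tmul H D) * (T.tensor T).expTau (-(tmul D H))

end Tower

/-! ### The algebra `U_τ(sl(2,ℝ))` -/

inductive Sl2Gen
  | H | D | C₁

namespace Sl2

/-- The free generators. -/
abbrev X (g : Sl2Gen) : FreeAlgebra ℝ⟦X⟧ Sl2Gen := FreeAlgebra.ι ℝ⟦X⟧ g

open Sl2Gen in
/-- The defining relations modulo `τ ^ n`. -/
inductive Rel (n : ℕ) : FreeAlgebra ℝ⟦X⟧ Sl2Gen → FreeAlgebra ℝ⟦X⟧ Sl2Gen → Prop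
  | tau_pow : Rel n (algebraMap _ _ (τ ^ n)) 0
  | DH : Rel n ⁅X D, X H⁆ (-(expSubOneDivTrunc n (-(X H))))
  | DC₁ : Rel n ⁅X D, X C₁⁆ (-(X C₁) + τ • X D ^ 2)
  | HC₁ : Rel n ⁅X H, X C₁⁆ (-(2 * X D))

/-- `U_τ(sl(2,ℝ))` modulo `τ ^ n`. -/
def Level (n : ℕ) : Type := RingQuot (Rel n)

instance (n : ℕ) : Ring (Level n) := inferInstanceAs (Ring (RingQuot (Rel n)))

instance (n : ℕ) : Algebra ℝ⟦X⟧ (Level n) := inferInstanceAs (Algebra ℝ⟦X⟧ (RingQuot (Rel n)))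

/-- The quotient map. -/
def mk (n : ℕ) : FreeAlgebra ℝ⟦X⟧ Sl2Gen →ₐ[ℝ⟦X⟧] Level n := RingQuot.mkAlgHom ℝ⟦X⟧ (Rel n)

lemma mk_rel {n : ℕ} {x y : FreeAlgebra ℝ⟦X⟧ Sl2Gen} (h : Rel n x y) : mk n x = mk n y :=
  RingQuot.mkAlgHom_rel ℝ⟦X⟧ h

/-- The universal property of the quotient. -/
def lift (n : ℕ) {B : Type*} [Ring B] [Algebra ℝ⟦X⟧ B] (f : FreeAlgebra ℝ⟦X⟧ Sl2Gen →ₐ[ℝ⟦X⟧] B)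
    (h : ∀ ⦃x y⦄, Rel n x y → f x = f y) : Level n →ₐ[ℝ⟦X⟧] B :=
  RingQuot.liftAlgHom ℝ⟦X⟧ ⟨f, h⟩

lemma lift_mk (n : ℕ) {B : Type*} [Ring B] [Algebra ℝ⟦X⟧ B]
    (f : FreeAlgebra ℝ⟦X⟧ Sl2Gen →ₐ[ℝ⟦X⟧] B) (h : ∀ ⦃x y⦄, Rel n x y → f x = f y)
    (a : FreeAlgebra ℝ⟦X⟧ Sl2Gen) : lift n f h (mk n a) = f a :=
  RingQuot.liftAlgHom_mkAlgHom_apply ℝ⟦X⟧ f h a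

/-- The generators modulo `τ ^ n`. -/
def gen (n : ℕ) (g : Sl2Gen) : Level n := mk n (X g)

lemma tau_pow (n : ℕ) : algebraMap ℝ⟦X⟧ (Level n) (τ ^ n) = 0 := by
  have := mk_rel (Rel.tau_pow (n := n))
  rwa [AlgHom.commutes, map_zero] at this

lemma rel_succ (n : ℕ) ⦃x y : FreeAlgebra ℝ⟦X⟧ Sl2Gen⦄ (h : Rel (n + 1) x y) :
    mk n x = mk n y := by
  have h0 := tau_pow n
  cases h with
  | tau_pow => rw [AlgHom.commutes, pow_succ, map_mul, h0, zero_mul, map_zero]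
  | DH =>
    rw [mk_rel (Rel.DH (n := n)), map_neg, map_neg, map_expSubOneDivTrunc,
      map_expSubOneDivTrunc, expSubOneDivTrunc_succ h0]
  | DC₁ => exact mk_rel Rel.DC₁
  | HC₁ => exact mk_rel Rel.HC₁

/-- `U_τ(sl(2,ℝ))`; the complete algebra itself is `Sl2.U.limit`. -/
def U : Tower where
  obj := Level
  proj n := lift (n + 1) (mk n) (rel_succ n)
  tau_pow := tau_pow

/-- The generators of `U_τ(sl(2,ℝ))`. -/
def x (g : Sl2Gen) : U.limit :=
  ⟨fun n => gen n g, fun n => lift_mk (n + 1) (mk n) (rel_succ n) (X g)⟩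

open Sl2Gen Tower in
/-- The values of the coproduct on the generators. -/
structure IsCoproduct (Δ : Hom U (U.tensor U)) : Prop where
  val_H : Δ.lim (x H) = tmul 1 (x H) + tmul (x H) 1
  val_D : Δ.lim (x D) = tmul 1 (x D) + tmul (x D) (U.expTau (-(x H)))
  val_C₁ : Δ.lim (x C₁) = tmul 1 (x C₁) + tmul (x C₁) (U.expTau (-(x H)))

end Sl2

/-! ### The algebra `U_τ(so(2,2))` -/

inductive So22Gen
  | H | P | K | D | C₁ | C₂

namespace So22

/-- The free generators. -/
abbrev X (g : So22Gen) : FreeAlgebra ℝ⟦X⟧ So22Gen := FreeAlgebra.ι ℝ⟦X⟧ g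

open So22Gen in
/-- The defining relations modulo `τ ^ n`. -/
inductive Rel (n : ℕ) : FreeAlgebra ℝ⟦X⟧ So22Gen → FreeAlgebra ℝ⟦X⟧ So22Gen → Prop
  | tau_pow : Rel n (algebraMap _ _ (τ ^ n)) 0
  | KH : Rel n ⁅X K, X H⁆ (expTrunc n (-(X H)) * X P)
  | KP : Rel n ⁅X K, X P⁆ (expSubOneDivTrunc n (X H))
  | HP : Rel n ⁅X H, X P⁆ 0
  | DH : Rel n ⁅X D, X H⁆ (-(expSubOneDivTrunc n (-(X H))))
  | DC₁ : Rel n ⁅X D, X C₁⁆ (-(X C₁) + τ • X D ^ 2)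
  | HC₁ : Rel n ⁅X H, X C₁⁆ (-(2 * X D))
  | DP : Rel n ⁅X D, X P⁆ (X P)
  | DC₂ : Rel n ⁅X D, X C₂⁆ (-(X C₂))
  | PC₂ : Rel n ⁅X P, X C₂⁆ (2 * X D)
  | KC₁ : Rel n ⁅X K, X C₁⁆ (X C₂)
  | KC₂ : Rel n ⁅X K, X C₂⁆ (X C₁ - τ • X D ^ 2)
  | C₁C₂ : Rel n ⁅X C₁, X C₂⁆ (-(τ • (X D * X C₂ + X C₂ * X D)))
  | HC₂ : Rel n ⁅X H, X C₂⁆ (expTrunc n (-(X H)) * X K + X K * expTrunc n (-(X H)))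
  | PC₁ : Rel n ⁅X P, X C₁⁆ (-(2 * X K) - τ • (X D * X P + X P * X D))
  | KD : Rel n ⁅X K, X D⁆ 0

/-- `U_τ(so(2,2))` modulo `τ ^ n`. -/
def Level (n : ℕ) : Type := RingQuot (Rel n)

instance (n : ℕ) : Ring (Level n) := inferInstanceAs (Ring (RingQuot (Rel n)))

instance (n : ℕ) : Algebra ℝ⟦X⟧ (Level n) := inferInstanceAs (Algebra ℝ⟦X⟧ (RingQuot (Rel n)))

/-- The quotient map. -/
def mk (n : ℕ) : FreeAlgebra ℝ⟦X⟧ So22Gen →ₐ[ℝ⟦X⟧] Level n := RingQuot.mkAlgHom ℝ⟦X⟧ (Rel n)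

lemma mk_rel {n : ℕ} {x y : FreeAlgebra ℝ⟦X⟧ So22Gen} (h : Rel n x y) : mk n x = mk n y :=
  RingQuot.mkAlgHom_rel ℝ⟦X⟧ h

/-- The universal property of the quotient. -/
def lift (n : ℕ) {B : Type*} [Ring B] [Algebra ℝ⟦X⟧ B] (f : FreeAlgebra ℝ⟦X⟧ So22Gen →ₐ[ℝ⟦X⟧] B)
    (h : ∀ ⦃x y⦄, Rel n x y → f x = f y) : Level n →ₐ[ℝ⟦X⟧] B :=
  RingQuot.liftAlgHom ℝ⟦X⟧ ⟨f, h⟩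

lemma lift_mk (n : ℕ) {B : Type*} [Ring B] [Algebra ℝ⟦X⟧ B]
    (f : FreeAlgebra ℝ⟦X⟧ So22Gen →ₐ[ℝ⟦X⟧] B) (h : ∀ ⦃x y⦄, Rel n x y → f x = f y)
    (a : FreeAlgebra ℝ⟦X⟧ So22Gen) : lift n f h (mk n a) = f a :=
  RingQuot.liftAlgHom_mkAlgHom_apply ℝ⟦X⟧ f h a

/-- The generators modulo `τ ^ n`. -/
def gen (n : ℕ) (g : So22Gen) : Level n := mk n (X g)

lemma tau_pow (n : ℕ) : algebraMap ℝ⟦X⟧ (Level n) (τ ^ n) = 0 := by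
  have := mk_rel (Rel.tau_pow (n := n))
  rwa [AlgHom.commutes, map_zero] at this

lemma rel_succ (n : ℕ) ⦃x y : FreeAlgebra ℝ⟦X⟧ So22Gen⦄ (h : Rel (n + 1) x y) :
    mk n x = mk n y := by
  have h0 := tau_pow n
  cases h with
  | tau_pow => rw [AlgHom.commutes, pow_succ, map_mul, h0, zero_mul, map_zero]
  | KH =>
    rw [mk_rel (Rel.KH (n := n)), map_mul, map_mul, map_expTrunc,
      map_expTrunc, expTrunc_succ h0]
  | KP =>
    rw [mk_rel (Rel.KP (n := n)), map_expSubOneDivTrunc,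
      map_expSubOneDivTrunc, expSubOneDivTrunc_succ h0]
  | HP => exact mk_rel Rel.HP
  | DH =>
    rw [mk_rel (Rel.DH (n := n)), map_neg, map_neg, map_expSubOneDivTrunc,
      map_expSubOneDivTrunc, expSubOneDivTrunc_succ h0]
  | DC₁ => exact mk_rel Rel.DC₁
  | HC₁ => exact mk_rel Rel.HC₁
  | DP => exact mk_rel Rel.DP
  | DC₂ => exact mk_rel Rel.DC₂
  | PC₂ => exact mk_rel Rel.PC₂
  | KC₁ => exact mk_rel Rel.KC₁
  | KC₂ => exact mk_rel Rel.KC₂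
  | C₁C₂ => exact mk_rel Rel.C₁C₂
  | HC₂ =>
    rw [mk_rel (Rel.HC₂ (n := n))]
    simp only [map_add, map_mul, map_expTrunc, expTrunc_succ h0]
  | PC₁ => exact mk_rel Rel.PC₁
  | KD => exact mk_rel Rel.KD

/-- `U_τ(so(2,2))`; the complete algebra itself is `So22.U.limit`. -/
def U : Tower where
  obj := Level
  proj n := lift (n + 1) (mk n) (rel_succ n)
  tau_pow := tau_pow

/-- The generators of `U_τ(so(2,2))`. -/
def x (g : So22Gen) : U.limit :=
  ⟨fun n => gen n g, fun n => lift_mk (n + 1) (mk n) (rel_succ n) (X g)⟩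

/-- `e^{s τ H}` for an integer `s`. -/
def E (s : ℤ) : U.limit := U.expTau (s • x So22Gen.H)

open So22Gen Tower in
/-- The values of the coproduct on the generators. -/
structure IsCoproduct (Δ : Hom U (U.tensor U)) : Prop where
  val_H : Δ.lim (x H) = tmul 1 (x H) + tmul (x H) 1
  val_P : Δ.lim (x P) = tmul 1 (x P) + tmul (x P) (E 1)
  val_D : Δ.lim (x D) = tmul 1 (x D) + tmul (x D) (E (-1))
  val_C₁ : Δ.lim (x C₁) = tmul 1 (x C₁) + tmul (x C₁) (E (-1))
  val_K : Δ.lim (x K) = tmul 1 (x K) + tmul (x K) 1 - τ • tmul (x D) (E (-1) * x P)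
  val_C₂ : Δ.lim (x C₂) = tmul 1 (x C₂) + tmul (x C₂) (E (-1))
    + (2 * τ) • tmul (x D) (E (-1) * x K)
    - τ ^ 2 • tmul (x D * (x D + 1)) (E (-2) * x P)

end So22

end QuantumSO

end

/-! The coproduct is a twist of a cocommutative one. Put `F = e^{τ D ⊗ H}` and let `Ψ` be
conjugation by `F`. The elements `h = (e^{τ H} - 1) / τ`, `P`, `K`, `D`, `C₁ - τ D ^ 2`, `C₂` have
brackets free of `τ` wherever these are needed below, and `Ψ` sends the primitive element `a ⊗ 1 + 1
⊗ a` of each of them to its coproduct (the `twist_prim_*` lemmas). As `Ψ` is an algebra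
homomorphism, the coproducts inherit these brackets. What remains are the brackets with `H`:
`[D,H]`, `[H,C₁]`, `[K,H]` and `[H,P]` are checked by hand, and `[H,C₂]` follows by Jacobi
(`IsSl2.isSo22`). So `Δ` exists.

The element `R` is `F₂₁ F⁻¹`, with `F₂₁` the flip of `F`. Hence `R d = d^op R` as soon as `F⁻¹ d F`
is symmetric (`rMatrixTrunc_mul`). This is clear for the coproducts of `P`, `K`, `D`, `C₂`, where
`F⁻¹ d F` is primitive. For `C₁` one adds `τ` times the square of the primitive element of `D`; for
`H` one recovers `H` from `h`, because `a ↦ (e^{τ a} - 1) / τ` is injective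
(`expSubOneDivTrunc_injective`).

Both hexagons reduce to a single identity between exponentials (`expTrunc_hexagon`). It is proved by
writing `e^{τ c a} = (1 + τ u) ^ c` with `u = (e^{τ a} - 1) / τ` and by a noncommutative Vandermonde
identity for falling factorials (`aeval_add_mul_descPochhammer`). They involve only `H` and `D`, so
the same argument serves both algebras.

Everything is done modulo `τ ^ n`, where exponentials are finite sums and all identities are exact,
and is then passed to the inverse limit. -/

noncomputable section

namespace QuantumSO

/-! ### Truncated exponentials in an algebra killed by `τ ^ n`. -/

section Series

variable {B : Type*} [Ring B] [Algebra ℝ⟦X⟧ B] {n : ℕ}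

/-- The sum `∑_{i < n} τ ^ i x_i`. -/
def truncSum (n : ℕ) (x : ℕ → B) : B := ∑ i ∈ Finset.range n, τ ^ i • x i

lemma tau_pow_smul (hn : algebraMap ℝ⟦X⟧ B (τ ^ n) = 0) {k : ℕ} (hk : n ≤ k) (b : B) :
    τ ^ k • b = 0 := by
  obtain ⟨m, rfl⟩ := Nat.exists_eq_add_of_le hk
  rw [Algebra.smul_def, pow_add, map_mul, hn, zero_mul, zero_mul]

lemma truncSum_of_le (hn : algebraMap ℝ⟦X⟧ B (τ ^ n) = 0) {m : ℕ} (hm : n ≤ m) (x : ℕ → B) :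
    truncSum m x = truncSum n x := by
  symm
  apply Finset.sum_subset (by simpa using hm)
  intro i _ hi
  exact tau_pow_smul hn (by simpa using hi) _

/-- Cauchy product: the square of index pairs and the triangle `i + j < n` differ only by terms
divisible by `τ ^ n`. -/
lemma truncSum_mul (hn : algebraMap ℝ⟦X⟧ B (τ ^ n) = 0) (x y : ℕ → B) :
    truncSum n x * truncSum n y
      = truncSum n fun k => ∑ p ∈ Finset.HasAntidiagonal.antidiagonal k, x p.1 * y p.2 := by
  have h1 : truncSum n x * truncSum n y = ∑ p ∈ Finset.range n ×ˢ Finset.range n,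
      τ ^ (p.1 + p.2) • (x p.1 * y p.2) := by
    rw [truncSum, truncSum, Finset.sum_mul_sum, Finset.sum_product]
    refine Finset.sum_congr rfl fun i _ => Finset.sum_congr rfl fun j _ => ?_
    rw [smul_mul_smul_comm, pow_add]
  have h2 : (truncSum n fun k => ∑ p ∈ Finset.HasAntidiagonal.antidiagonal k, x p.1 * y p.2)
      = ∑ p ∈ (Finset.range n ×ˢ Finset.range n).filter (fun p => p.1 + p.2 < n),
      τ ^ (p.1 + p.2) • (x p.1 * y p.2) := by
    rw [truncSum, ← Finset.sum_fiberwise_of_maps_to (t := Finset.range n)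
      (g := fun p : ℕ × ℕ => p.1 + p.2) (by simp)]
    refine Finset.sum_congr rfl fun k hk => ?_
    rw [Finset.smul_sum]
    simp only [Finset.mem_range] at hk
    refine Finset.sum_congr ?_ ?_
    · ext p; simp; omega
    · rintro p hp
      simp at hp
      rw [hp.2]
  rw [h1, h2, Finset.sum_filter]
  refine Finset.sum_congr rfl fun p _ => ?_
  split_ifs with h
  · rfl
  · exact tau_pow_smul hn (by omega) _

lemma monomial_eq_smul (i : ℕ) (r : ℝ) :
    PowerSeries.monomial (R := ℝ) i r = τ ^ i * PowerSeries.C r := by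
  ext m
  simp [PowerSeries.coeff_monomial, PowerSeries.coeff_X_pow]

lemma expTrunc_eq (a : B) :
    expTrunc n a = truncSum n fun i => PowerSeries.C (R := ℝ) ((i ! : ℝ)⁻¹) • a ^ i := by
  simp only [expTrunc, truncSum, monomial_eq_smul, mul_smul]

lemma expSubOneDivTrunc_eq (a : B) :
    expSubOneDivTrunc n a =
      truncSum n fun i => PowerSeries.C (R := ℝ) (((i + 1)! : ℝ)⁻¹) • a ^ (i + 1) := by
  simp only [expSubOneDivTrunc, truncSum, monomial_eq_smul, mul_smul]

lemma truncSum_add (x y : ℕ → B) :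
    truncSum n (fun i => x i + y i) = truncSum n x + truncSum n y := by
  simp [truncSum, Finset.sum_add_distrib]

lemma C_smul_C_smul (r s : ℝ) (b : B) : PowerSeries.C (R := ℝ) r • PowerSeries.C (R := ℝ) s • b =
    PowerSeries.C (R := ℝ) (r * s) • b := by
  rw [smul_smul, ← map_mul]

lemma natCast_smul_eq (m : ℕ) (b : B) : m • b = PowerSeries.C (R := ℝ) (m : ℝ) • b := by
  rw [map_natCast, Nat.cast_smul_eq_nsmul]

lemma choose_smul (k i : ℕ) (h : i ≤ k) (b : B) :
    PowerSeries.C (R := ℝ) ((k ! : ℝ)⁻¹) • (k.choose i • b) =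
      PowerSeries.C (R := ℝ) ((i ! : ℝ)⁻¹ * ((k - i)! : ℝ)⁻¹) • b := by
  rw [natCast_smul_eq, C_smul_C_smul, Nat.cast_choose ℝ h]
  congr 2
  have := Nat.factorial_ne_zero k
  field_simp

lemma inv_factorial_smul_add_pow {a b : B} (h : Commute a b) (k : ℕ) :
    PowerSeries.C (R := ℝ) ((k ! : ℝ)⁻¹) • (a + b) ^ k =
      ∑ p ∈ Finset.HasAntidiagonal.antidiagonal k,
      (PowerSeries.C (R := ℝ) ((p.1 ! : ℝ)⁻¹) • a ^ p.1) *
        (PowerSeries.C (R := ℝ) ((p.2 ! : ℝ)⁻¹) • b ^ p.2) := by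
  rw [h.add_pow', Finset.smul_sum]
  refine Finset.sum_congr rfl fun p hp => ?_
  rw [Finset.HasAntidiagonal.mem_antidiagonal] at hp
  rw [choose_smul _ _ (by omega), smul_mul_smul_comm, ← map_mul,
    show k - p.1 = p.2 by omega]

lemma expTrunc_add (hn : algebraMap ℝ⟦X⟧ B (τ ^ n) = 0) {a b : B} (h : Commute a b) :
    expTrunc n (a + b) = expTrunc n a * expTrunc n b := by
  simp only [expTrunc_eq, truncSum_mul hn, inv_factorial_smul_add_pow h]

lemma expSubOneDivTrunc_add (hn : algebraMap ℝ⟦X⟧ B (τ ^ n) = 0) {a b : B} (h : Commute a b) :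
    expSubOneDivTrunc n (a + b) =
      expSubOneDivTrunc n a + expTrunc n a * expSubOneDivTrunc n b := by
  -- Among the pairs of sum `k + 1`, the one with second index `0` gives the first summand; the
  -- others have second index `j + 1` and give the product.
  simp only [expTrunc_eq, expSubOneDivTrunc_eq, truncSum_mul hn, inv_factorial_smul_add_pow h,
    ← truncSum_add, Finset.Nat.antidiagonal_succ', Finset.sum_cons, Finset.sum_map]
  simp

lemma expTrunc_zero (hn : algebraMap ℝ⟦X⟧ B (τ ^ n) = 0) : expTrunc n (0 : B) = 1 := by
  -- One term more than `n` is harmless and makes index `0` occur even for `n = 0`.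
  rw [expTrunc_eq, ← truncSum_of_le hn (Nat.le_succ n), truncSum, Finset.sum_range_succ']
  simp

lemma expSubOneDivTrunc_zero : expSubOneDivTrunc n (0 : B) = 0 := by
  simp [expSubOneDivTrunc]

lemma expTrunc_mul_neg (hn : algebraMap ℝ⟦X⟧ B (τ ^ n) = 0) (a : B) :
    expTrunc n a * expTrunc n (-a) = 1 := by
  rw [← expTrunc_add hn (Commute.refl a).neg_right, add_neg_cancel, expTrunc_zero hn]

lemma expTrunc_neg_mul (hn : algebraMap ℝ⟦X⟧ B (τ ^ n) = 0) (a : B) :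
    expTrunc n (-a) * expTrunc n a = 1 := by
  simpa using expTrunc_mul_neg hn (-a)

lemma tau_smul_expSubOneDivTrunc (hn : algebraMap ℝ⟦X⟧ B (τ ^ n) = 0) (a : B) :
    τ • expSubOneDivTrunc n a = expTrunc n a - 1 := by
  rw [eq_sub_iff_add_eq, expTrunc_eq, ← truncSum_of_le hn (Nat.le_succ n), truncSum,
    Finset.sum_range_succ', expSubOneDivTrunc_eq, truncSum, Finset.smul_sum]
  simp [pow_succ', mul_smul]

lemma expSubOneDivTrunc_neg (hn : algebraMap ℝ⟦X⟧ B (τ ^ n) = 0) (a : B) :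
    expSubOneDivTrunc n (-a) = -(expTrunc n (-a) * expSubOneDivTrunc n a) := by
  have := expSubOneDivTrunc_add hn (Commute.refl a).neg_left
  rw [neg_add_cancel, expSubOneDivTrunc_zero] at this
  exact eq_neg_of_add_eq_zero_left this.symm

lemma _root_.SemiconjBy.truncSum {b : B} {x y : ℕ → B} (h : ∀ i, SemiconjBy b (x i) (y i)) :
    SemiconjBy b (truncSum n x) (truncSum n y) := by
  simp only [SemiconjBy, QuantumSO.truncSum, Finset.mul_sum, Finset.sum_mul]
  refine Finset.sum_congr rfl fun i _ => ?_
  rw [mul_smul_comm, (h i).eq, smul_mul_assoc]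

lemma _root_.SemiconjBy.algebra_smul {b x y : B} (h : SemiconjBy b x y) (r : ℝ⟦X⟧) :
    SemiconjBy b (r • x) (r • y) := by
  rw [SemiconjBy, mul_smul_comm, h.eq, smul_mul_assoc]

lemma _root_.SemiconjBy.expTrunc {b x y : B} (h : SemiconjBy b x y) :
    SemiconjBy b (expTrunc n x) (expTrunc n y) := by
  simp only [expTrunc_eq]
  exact .truncSum fun i => (h.pow_right i).algebra_smul _

lemma _root_.SemiconjBy.expSubOneDivTrunc {b x y : B} (h : SemiconjBy b x y) :
    SemiconjBy b (expSubOneDivTrunc n x) (expSubOneDivTrunc n y) := by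
  simp only [expSubOneDivTrunc_eq]
  exact .truncSum fun i => (h.pow_right _).algebra_smul _

lemma _root_.Commute.expTrunc {b x : B} (h : Commute b x) : Commute b (expTrunc n x) :=
  SemiconjBy.expTrunc h

lemma _root_.Commute.expSubOneDivTrunc {b x : B} (h : Commute b x) :
    Commute b (expSubOneDivTrunc n x) :=
  SemiconjBy.expSubOneDivTrunc h

/-- `e^{τ a} b = (e^{τ ad a} b) e^{τ a}` when `(ad a) ^ 3 b = 0`. -/
lemma expTrunc_mul_of_lie (hn : algebraMap ℝ⟦X⟧ B (τ ^ n) = 0) {a b b' b'' : B}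
    (h : ⁅a, b⁆ = b') (h' : ⁅a, b'⁆ = 2 * b'') (h'' : Commute a b'') :
    expTrunc n a * b = (b + τ • b' + τ ^ 2 • b'') * expTrunc n a := by
  -- Left multiplication by `a` is the sum of the commuting operators `ad a` and right
  -- multiplication by `a`, so the binomial theorem expands `a ^ k * b`.
  set ad := LinearMap.mulLeft ℝ⟦X⟧ a - LinearMap.mulRight ℝ⟦X⟧ a with had
  have hc : Commute ad (LinearMap.mulRight ℝ⟦X⟧ a) :=
    (LinearMap.commute_mulLeft_right a a).sub_left (Commute.refl _)
  have hpow (k : ℕ) : PowerSeries.C (R := ℝ) ((k ! : ℝ)⁻¹) • a ^ k * b =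
      ∑ p ∈ Finset.HasAntidiagonal.antidiagonal k,
        (PowerSeries.C (R := ℝ) ((p.1 ! : ℝ)⁻¹) • (ad ^ p.1) b) *
        (PowerSeries.C (R := ℝ) ((p.2 ! : ℝ)⁻¹) • a ^ p.2) := by
    have : (LinearMap.mulLeft ℝ⟦X⟧ a ^ k) b = ((ad + LinearMap.mulRight ℝ⟦X⟧ a) ^ k) b := by
      simp [had]
    rw [LinearMap.pow_mulLeft, LinearMap.mulLeft_apply] at this
    rw [smul_mul_assoc, this, hc.add_pow', LinearMap.sum_apply, Finset.smul_sum]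
    refine Finset.sum_congr rfl fun p hp => ?_
    rw [Finset.HasAntidiagonal.mem_antidiagonal] at hp
    rw [LinearMap.smul_apply, choose_smul _ _ (by omega), smul_mul_smul_comm, ← map_mul,
      show k - p.1 = p.2 by omega, (hc.pow_pow _ _).eq]
    simp [LinearMap.pow_mulRight]
  have e0 : ad b = b' := by simp [had, ← h, Ring.lie_def]
  have e1 : ad b' = 2 * b'' := by simp [had, ← h', Ring.lie_def]
  have e2 : ad (2 * b'') = 0 := by
    simp [had, two_mul, mul_add, add_mul, h''.eq]
  have e3 (i : ℕ) : (ad ^ (i + 1 + 1 + 1)) b = 0 := by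
    rw [add_assoc, add_assoc, pow_add, Module.End.mul_apply]
    simp [pow_succ, e0, e1, e2]
  have key : expTrunc n a * b = truncSum n (fun i => PowerSeries.C (R := ℝ) ((i ! : ℝ)⁻¹) •
      (ad ^ i) b) * expTrunc n a := by
    rw [expTrunc_eq, truncSum_mul hn, truncSum, Finset.sum_mul]
    refine Finset.sum_congr rfl fun k _ => ?_
    rw [smul_mul_assoc, hpow]
  -- With `n + 3` terms the indices `0`, `1`, `2` are present for every `n`; the remaining ones
  -- involve `(ad a) ^ 3 b = 0`.
  rw [key, ← truncSum_of_le hn (show n ≤ n + 3 by omega), truncSum, Finset.sum_range_succ',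
    Finset.sum_range_succ', Finset.sum_range_succ',
    Finset.sum_eq_zero fun i _ => by rw [e3, smul_zero, smul_zero]]
  congr 1
  have e4 : PowerSeries.C (R := ℝ) (2⁻¹ : ℝ) • (2 * b'') = b'' := by
    have : (2 : B) * b'' = PowerSeries.C (R := ℝ) (2 : ℝ) • b'' := by
      rw [two_mul, ← two_nsmul, natCast_smul_eq]; norm_num
    rw [this, C_smul_C_smul]
    norm_num
  simp [pow_succ, e0, e1, e4]
  abel

/-- `e^{τ a} b = (b + τ [a, b]) e^{τ a}` when `[a, b]` commutes with `a`. -/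
lemma expTrunc_mul_of_lie_commute (hn : algebraMap ℝ⟦X⟧ B (τ ^ n) = 0) {a b b' : B}
    (h : ⁅a, b⁆ = b') (h' : Commute a b') :
    expTrunc n a * b = (b + τ • b') * expTrunc n a := by
  have := expTrunc_mul_of_lie (n := n) (b'' := 0) hn h
    (by rw [Ring.lie_def, h'.eq, sub_self, mul_zero]) (Commute.zero_right a)
  simpa using this

lemma lie_expTrunc (hn : algebraMap ℝ⟦X⟧ B (τ ^ n) = 0) {d a b : B}
    (h : ⁅d, a⁆ = b) (hb : Commute a b) : ⁅d, expTrunc n a⁆ = τ • (b * expTrunc n a) := by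
  have := expTrunc_mul_of_lie_commute (n := n) (a := a) (b := d) (b' := -b) hn
    (by rw [← h, Ring.lie_def, Ring.lie_def, neg_sub]) hb.neg_right
  rw [Ring.lie_def, this]
  simp [add_mul]

/-- This is `lie_expTrunc` divided by `τ`. Since `τ` is nilpotent when `τ ^ n = 0`, it cannot be
cancelled there, and the derivation `[d, ·]` is applied term by term. -/
lemma lie_expSubOneDivTrunc {d a b : B} (h : ⁅d, a⁆ = b) (hb : Commute a b) :
    ⁅d, expSubOneDivTrunc n a⁆ = b * expTrunc n a := by
  have hk (k : ℕ) : ⁅d, a ^ (k + 1)⁆ = (k + 1) • (b * a ^ k) := by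
    induction k with
    | zero => simp [h]
    | succ k ih =>
      have : ⁅d, a ^ (k + 1 + 1)⁆ = ⁅d, a ^ (k + 1)⁆ * a + a ^ (k + 1) * ⁅d, a⁆ := by
        rw [pow_succ _ (k + 1)]; simp only [Ring.lie_def]; noncomm_ring
      rw [this, ih, h, (hb.pow_left _).eq, smul_mul_assoc, mul_assoc, ← pow_succ, succ_nsmul]
      simp only [add_smul, one_smul]
  rw [Ring.lie_def, expSubOneDivTrunc_eq, expTrunc_eq, truncSum, truncSum, Finset.mul_sum,
    Finset.sum_mul, Finset.mul_sum, ← Finset.sum_sub_distrib]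
  refine Finset.sum_congr rfl fun k _ => ?_
  rw [mul_smul_comm, smul_mul_assoc, mul_smul_comm, smul_mul_assoc, ← smul_sub, ← smul_sub,
    ← Ring.lie_def, hk, natCast_smul_eq, C_smul_C_smul, mul_smul_comm, mul_smul_comm]
  congr 3
  rw [Nat.factorial_succ]
  have := Nat.factorial_ne_zero k
  push_cast
  field_simp

/-- The series is `a` plus multiples of `τ`. If two elements have the same value and differ by a
multiple of `τ ^ k`, so do their powers, and comparing the higher terms shows that they differ by a
multiple of `τ ^ (k + 1)`. -/
lemma expSubOneDivTrunc_injective (hn : algebraMap ℝ⟦X⟧ B (τ ^ n) = 0) :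
    Function.Injective (expSubOneDivTrunc n : B → B) := by
  intro x y hxy
  -- The extra term guarantees that the linear term can be split off.
  have hxy' : expSubOneDivTrunc (n + 1) x = expSubOneDivTrunc (n + 1) y := by
    rw [expSubOneDivTrunc_succ hn, expSubOneDivTrunc_succ hn, hxy]
  have hpow (k : ℕ) (i : ℕ) (hk : ∃ z, x - y = τ ^ k • z) :
      ∃ z, x ^ i - y ^ i = τ ^ k • z := by
    obtain ⟨z, hz⟩ := hk
    induction i with
    | zero => exact ⟨0, by simp⟩
    | succ i ih =>
      obtain ⟨w, hw⟩ := ih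
      refine ⟨w * x + y ^ i * z, ?_⟩
      rw [smul_add, ← smul_mul_assoc, ← mul_smul_comm, ← hz, ← hw]
      noncomm_ring
  have main (k : ℕ) : ∃ z, x - y = τ ^ k • z := by
    induction k with
    | zero => exact ⟨x - y, by simp⟩
    | succ k ih =>
      choose z hz using fun i => hpow k i ih
      rw [expSubOneDivTrunc_eq, expSubOneDivTrunc_eq, truncSum, truncSum, Finset.sum_range_succ',
        Finset.sum_range_succ'] at hxy'
      refine ⟨-∑ i ∈ Finset.range n, τ ^ i •
        PowerSeries.C (R := ℝ) (((i + 1 + 1)! : ℝ)⁻¹) • z (i + 1 + 1), ?_⟩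
      have : x - y = -∑ i ∈ Finset.range n, τ ^ (i + 1) •
        PowerSeries.C (R := ℝ) (((i + 1 + 1)! : ℝ)⁻¹) • (x ^ (i + 1 + 1) - y ^ (i + 1 + 1)) := by
        simp only [smul_sub, Finset.sum_sub_distrib]
        simp at hxy'
        rw [neg_sub, sub_eq_sub_iff_add_eq_add, add_comm x, add_comm _ y, hxy', add_comm]
      rw [this, smul_neg, Finset.smul_sum]
      congr 1
      refine Finset.sum_congr rfl fun i _ => ?_
      rw [hz, smul_smul, smul_smul, smul_smul, smul_smul]
      congr 1
      ring
  obtain ⟨z, hz⟩ := main n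
  rw [← sub_eq_zero, hz, tau_pow_smul hn le_rfl]

end Series

/-! ### The binomial series with noncommutative exponent and the hexagon identity. -/

section Binomial

variable {B : Type*} [Ring B] [Algebra ℝ⟦X⟧ B] {n : ℕ}

/-- A polynomial with coefficients in a real vector space that vanishes at all natural numbers is
zero. -/
lemma eq_zero_of_forall_sum_pow_smul {V : Type*} [AddCommGroup V] [Module ℝ V] {N : ℕ}
    {b : ℕ → V} (h : ∀ m : ℕ, ∑ i ∈ Finset.range N, (m : ℝ) ^ i • b i = 0) {i : ℕ} (hi : i < N) :
    b i = 0 := by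
  -- A linear functional turns the family into a real polynomial with infinitely many roots.
  rw [← Module.forall_dual_apply_eq_zero_iff ℝ]
  intro g
  set p : Polynomial ℝ := ∑ i ∈ Finset.range N, Polynomial.monomial i (g (b i)) with hp
  have h0 : p = 0 := by
    refine Polynomial.eq_zero_of_infinite_isRoot p
      ((Set.infinite_range_of_injective (Nat.cast_injective (R := ℝ))).mono ?_)
    rintro _ ⟨m, rfl⟩
    have := congrArg g (h m)
    simp only [map_sum, map_smul, map_zero, smul_eq_mul] at this
    simp only [Set.mem_ofPred_eq, Polynomial.IsRoot.def, hp, Polynomial.eval_finsetSum,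
      Polynomial.eval_monomial]
    rw [← this]
    exact Finset.sum_congr rfl fun i _ => mul_comm _ _
  have := congrArg (fun q => q.coeff i) h0
  simpa [hp, Polynomial.coeff_monomial, hi] using this

/-- The binomial series `(1 + τ u) ^ c = ∑_k τ ^ k / k! c (c - 1) ⋯ (c - k + 1) u ^ k`
modulo `τ ^ n`. -/
def binomTrunc (n : ℕ) (c u : B) : B :=
  truncSum n fun k => PowerSeries.C (R := ℝ) ((k ! : ℝ)⁻¹) •
    (Polynomial.aeval c (descPochhammer ℝ⟦X⟧ k) * u ^ k)

lemma aeval_descPochhammer_succ (c : B) (k : ℕ) :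
    Polynomial.aeval c (descPochhammer ℝ⟦X⟧ (k + 1)) =
      Polynomial.aeval c (descPochhammer ℝ⟦X⟧ k) * (c - k) := by
  simp [descPochhammer_succ_right]

lemma aeval_natCast_descPochhammer (m k : ℕ) :
    Polynomial.aeval (m : B) (descPochhammer ℝ⟦X⟧ k) = (m.descFactorial k : B) := by
  rw [← map_natCast (algebraMap ℝ⟦X⟧ B) m, Polynomial.aeval_algebraMap_apply,
    Polynomial.coe_aeval_eq_eval, descPochhammer_eval_eq_descFactorial, map_natCast]

lemma _root_.Commute.aeval_descPochhammer {c x : B} (h : Commute x c) (k : ℕ) :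
    Commute x (Polynomial.aeval c (descPochhammer ℝ⟦X⟧ k)) := by
  induction k with
  | zero => simp
  | succ k ih =>
    rw [aeval_descPochhammer_succ]
    exact ih.mul_right (h.sub_right (Nat.cast_commute k x).symm)

/-- For a natural exponent the left side is `(e^{τ a}) ^ m = (1 + τ u) ^ m`, with the ordinary
binomial expansion. -/
lemma expTrunc_natCast_mul (hn : algebraMap ℝ⟦X⟧ B (τ ^ n) = 0) (m : ℕ) (a : B) :
    expTrunc n (m * a) = binomTrunc n (m : B) (expSubOneDivTrunc n a) := by
  have h1 : expTrunc n (m * a) = (1 + τ • expSubOneDivTrunc n a) ^ m := by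
    rw [tau_smul_expSubOneDivTrunc hn, add_sub_cancel]
    induction m with
    | zero => simp [expTrunc_zero hn]
    | succ m ih =>
      rw [Nat.cast_succ, add_mul, one_mul, expTrunc_add hn, ih, pow_succ]
      exact (Nat.cast_commute m a).mul_left (Commute.refl a)
  rw [h1, (Commute.one_left _).add_pow', Finset.Nat.sum_antidiagonal_eq_sum_range_succ_mk,
    ← Finset.sum_range_reflect, binomTrunc]
  have h2 (k : ℕ) : PowerSeries.C (R := ℝ) ((k ! : ℝ)⁻¹) •
      (Polynomial.aeval (m : B) (descPochhammer ℝ⟦X⟧ k) * expSubOneDivTrunc n a ^ k) =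
      m.choose k • expSubOneDivTrunc n a ^ k := by
    rw [aeval_natCast_descPochhammer, ← nsmul_eq_mul, natCast_smul_eq, C_smul_C_smul,
      Nat.descFactorial_eq_factorial_mul_choose, natCast_smul_eq]
    have := Nat.factorial_ne_zero k
    congr 2
    push_cast
    field_simp
  simp only [h2]
  -- Both sums are extended to `n + (m + 1)` terms: those from `n` on are killed by `τ ^ n`, those
  -- beyond `m` by the binomial coefficient.
  rw [← truncSum_of_le hn (Nat.le_add_right n (m + 1)), truncSum]
  symm
  rw [← Finset.sum_subset (Finset.range_mono (Nat.le_add_left (m + 1) n))]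
  · refine Finset.sum_congr rfl fun k hk => ?_
    simp only [Finset.mem_range] at hk
    rw [one_pow, one_mul, smul_pow, smul_comm, show m - (m.succ - 1 - k) = k by omega,
      show m.succ - 1 - k = m - k by omega, Nat.choose_symm (by omega)]
  · intro k _ hk
    rw [Nat.choose_eq_zero_of_lt (by simpa using hk), zero_smul, smul_zero]

/-- `e^{τ c a} = (1 + (e^{τ a} - 1)) ^ c`. -/
lemma expTrunc_mul_eq_binomTrunc (hn : algebraMap ℝ⟦X⟧ B (τ ^ n) = 0) {c a : B}
    (h : Commute c a) : expTrunc n (c * a) = binomTrunc n c (expSubOneDivTrunc n a) := by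
  set u := expSubOneDivTrunc n a
  -- The coefficient of `c ^ i` in the difference of the two sides. It does not depend on `c`, so
  -- vanishing at all natural numbers forces it to be zero.
  let b (i : ℕ) : B := τ ^ i • PowerSeries.C (R := ℝ) ((i ! : ℝ)⁻¹) • a ^ i -
    ∑ k ∈ Finset.range n, τ ^ k • PowerSeries.C (R := ℝ) ((k ! : ℝ)⁻¹) •
      (descPochhammer ℝ⟦X⟧ k).coeff i • u ^ k
  have key (c : B) (h : Commute c a) : expTrunc n (c * a) - binomTrunc n c u =
      ∑ i ∈ Finset.range n, c ^ i * b i := by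
    simp only [b, mul_sub, Finset.sum_sub_distrib, expTrunc_eq, truncSum, binomTrunc,
      Finset.mul_sum]
    congr 1
    · refine Finset.sum_congr rfl fun i _ => ?_
      rw [h.mul_pow, mul_smul_comm, mul_smul_comm]
    · rw [Finset.sum_comm]
      refine Finset.sum_congr rfl fun k hk => ?_
      have hk' : (descPochhammer ℝ⟦X⟧ k).natDegree < n := by
        rw [descPochhammer_natDegree]; simpa using hk
      rw [Polynomial.aeval_eq_sum_range' hk', Finset.sum_mul, Finset.smul_sum, Finset.smul_sum]
      refine Finset.sum_congr rfl fun i _ => ?_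
      simp only [mul_smul_comm, smul_mul_assoc]
  have hb (i : ℕ) (hi : i < n) : b i = 0 := by
    -- Real scalars act as constant power series, so the polynomial argument over `ℝ` applies.
    let _ : Module ℝ B := Module.compHom B (PowerSeries.C (R := ℝ))
    refine eq_zero_of_forall_sum_pow_smul (N := n) (fun m => ?_) hi
    have := key m (Nat.cast_commute m a)
    rw [expTrunc_natCast_mul hn, sub_self] at this
    rw [this]
    refine Finset.sum_congr rfl fun i _ => ?_
    change PowerSeries.C (R := ℝ) ((m : ℝ) ^ i) • b i = _
    rw [← Nat.cast_pow, ← Nat.cast_pow, ← natCast_smul_eq, nsmul_eq_mul]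
  rw [← sub_eq_zero, key c h]
  exact Finset.sum_eq_zero fun i hi => by rw [hb i (by simpa using hi), mul_zero]

lemma _root_.SemiconjBy.binomTrunc {b c u v : B} (hc : Commute b c) (h : SemiconjBy b u v) :
    SemiconjBy b (binomTrunc n c u) (binomTrunc n c v) :=
  .truncSum fun k => SemiconjBy.algebra_smul
    (SemiconjBy.mul_right (hc.aeval_descPochhammer k) (h.pow_right k)) _

/-- A Vandermonde identity for falling factorials; `f = 1` is the classical one. The induction rests
on `f ^ j (D + c f - i - j) = (D - i) f ^ j + (c - j) f ^ (j + 1)`: moving `D` to the left of `f ^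
j` produces `j f ^ j - j f ^ (j + 1)`, which splits the shift `i + j` between the two factors. -/
lemma aeval_add_mul_descPochhammer {D c f : B} (hcD : Commute c D) (hcf : Commute c f)
    (hDf : ⁅D, f⁆ = -f + f ^ 2) (k : ℕ) :
    Polynomial.aeval (D + c * f) (descPochhammer ℝ⟦X⟧ k) =
      ∑ p ∈ Finset.HasAntidiagonal.antidiagonal k, k.choose p.1 •
        (Polynomial.aeval D (descPochhammer ℝ⟦X⟧ p.1) *
          (Polynomial.aeval c (descPochhammer ℝ⟦X⟧ p.2) * f ^ p.2)) := by
  have hpow (j : ℕ) : f ^ j * D = D * f ^ j + j • (f ^ j - f ^ (j + 1)) := by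
    have h1 : f * D = D * f + f - f ^ 2 := by
      rw [Ring.lie_def, sub_eq_iff_eq_add] at hDf
      rw [hDf]; abel
    induction j with
    | zero => simp
    | succ j ih =>
      have : f ^ (j + 1) * D = (f ^ j * D) * f + f ^ (j + 1) - f ^ (j + 2) := by
        rw [pow_succ, mul_assoc, h1]; noncomm_ring
      rw [this, ih]
      simp only [add_smul, one_smul, smul_sub, add_mul, sub_mul, smul_mul_assoc, mul_assoc,
        ← pow_succ]
      abel
  induction k with
  | zero => simp
  | succ k ih =>
    rw [aeval_descPochhammer_succ, ih, Finset.sum_mul]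
    have hstep (p : ℕ × ℕ) (hp : p ∈ Finset.HasAntidiagonal.antidiagonal k) :
        (k.choose p.1 • (Polynomial.aeval D (descPochhammer ℝ⟦X⟧ p.1) *
          (Polynomial.aeval c (descPochhammer ℝ⟦X⟧ p.2) * f ^ p.2))) * (D + c * f - k) =
        k.choose p.1 • (Polynomial.aeval D (descPochhammer ℝ⟦X⟧ (p.1 + 1)) *
          (Polynomial.aeval c (descPochhammer ℝ⟦X⟧ p.2) * f ^ p.2)) +
        k.choose p.1 • (Polynomial.aeval D (descPochhammer ℝ⟦X⟧ p.1) *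
          (Polynomial.aeval c (descPochhammer ℝ⟦X⟧ (p.2 + 1)) * f ^ (p.2 + 1))) := by
      obtain ⟨i, j⟩ := p
      rw [Finset.HasAntidiagonal.mem_antidiagonal] at hp
      simp only at hp ⊢
      subst hp
      rw [← smul_add, smul_mul_assoc]
      congr 1
      rw [aeval_descPochhammer_succ, aeval_descPochhammer_succ]
      set x := Polynomial.aeval D (descPochhammer ℝ⟦X⟧ i)
      set y := Polynomial.aeval c (descPochhammer ℝ⟦X⟧ j)
      have hyD : D * y = y * D := hcD.symm.aeval_descPochhammer j
      have hfc : f ^ j * (c * f) = c * f ^ (j + 1) := by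
        rw [← mul_assoc, ← (hcf.pow_right j).eq, mul_assoc, pow_succ]
      have e1 : x * (y * f ^ j) * (D + c * f - ((i + j : ℕ) : B)) =
          x * y * (f ^ j * D + f ^ j * (c * f) - (i + j) • f ^ j) := by
        rw [nsmul_eq_mul, (Nat.cast_commute (i + j) (f ^ j)).eq]
        noncomm_ring
      have e2 : x * (D - (i : B)) * (y * f ^ j) = x * y * (D * f ^ j - i • f ^ j) := by
        rw [mul_assoc, ← mul_assoc _ y, sub_mul, hyD, ← (Nat.cast_commute i y).symm.eq,
          nsmul_eq_mul]
        noncomm_ring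
      have e3 : x * (y * (c - (j : B)) * f ^ (j + 1)) =
          x * y * (c * f ^ (j + 1) - j • f ^ (j + 1)) := by
        rw [nsmul_eq_mul]
        noncomm_ring
      rw [e1, e2, e3, hpow, hfc, ← mul_add]
      congr 1
      simp only [add_smul, smul_sub]
      abel
    rw [Finset.sum_congr rfl hstep, Finset.sum_add_distrib,
      Finset.sum_antidiagonal_choose_succ_nsmul (fun i j =>
        Polynomial.aeval D (descPochhammer ℝ⟦X⟧ i) *
          (Polynomial.aeval c (descPochhammer ℝ⟦X⟧ j) * f ^ j)) k]
    rw [add_comm]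
    congr 1
    refine Finset.sum_congr rfl fun p hp => ?_
    rw [Nat.choose_symm_of_eq_add (Finset.HasAntidiagonal.mem_antidiagonal.1 hp).symm]

/-- This reads `(1 + τ u) ^ (D + c f) = (1 + τ u) ^ D (1 + τ f u) ^ c`, the generating function of
the preceding identity. The powers of `u` only have to pass `c` and `f`, never `D`. -/
lemma binomTrunc_add_mul (hn : algebraMap ℝ⟦X⟧ B (τ ^ n) = 0) {D c f u : B}
    (hcD : Commute c D) (hcf : Commute c f) (hDf : ⁅D, f⁆ = -f + f ^ 2)
    (huc : Commute u c) (huf : Commute u f) :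
    binomTrunc n (D + c * f) u = binomTrunc n D u * binomTrunc n c (f * u) := by
  simp only [binomTrunc, truncSum_mul hn]
  congr 1
  ext k
  rw [aeval_add_mul_descPochhammer hcD hcf hDf, Finset.sum_mul, Finset.smul_sum]
  refine Finset.sum_congr rfl fun p hp => ?_
  rw [Finset.HasAntidiagonal.mem_antidiagonal] at hp
  rw [smul_mul_assoc, choose_smul _ _ (by omega), smul_mul_smul_comm, ← map_mul,
    show k - p.1 = p.2 by omega, huf.symm.mul_pow, ← hp, pow_add]
  congr 1
  have h1 : Commute (u ^ p.1) (Polynomial.aeval c (descPochhammer ℝ⟦X⟧ p.2) * f ^ p.2) :=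
    ((huc.aeval_descPochhammer _).mul_right (huf.pow_right _)).pow_left _
  rw [← mul_assoc, mul_assoc _ _ (u ^ p.1), ← h1.eq]
  simp only [mul_assoc]

/-- The identity behind both hexagons. -/
lemma expTrunc_hexagon (hn : algebraMap ℝ⟦X⟧ B (τ ^ n) = 0) {c D H D' H' : B}
    (hcD : Commute c D) (hcH : Commute c H) (hcD' : Commute c D') (hcH' : Commute c H')
    (hDH' : Commute D H') (hHD' : Commute H D') (hHH' : Commute H H')
    (hDf : ⁅D, expTrunc n (-H)⁆ = -expTrunc n (-H) + expTrunc n (-H) ^ 2)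
    (hDh : ⁅D', expSubOneDivTrunc n H'⁆ = expSubOneDivTrunc n H') :
    expTrunc n ((D + c * expTrunc n (-H)) * H') * expTrunc n (-(H * D')) =
      expTrunc n (D * H') * expTrunc n (-(H * D')) * expTrunc n (c * H') := by
  set f := expTrunc n (-H)
  have hcf : Commute c f := hcH.neg_right.expTrunc
  have hfH' : Commute f H' := (hHH'.symm.neg_right.expTrunc).symm
  set h := expSubOneDivTrunc n H' with hh
  have hch : Commute c h := hcH'.expSubOneDivTrunc
  have hfh : Commute f h := hfH'.expSubOneDivTrunc
  have hHh : Commute H h := hHH'.expSubOneDivTrunc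
  -- As `[D', h] = h`, conjugating `h` by `e^{-τ H D'}` multiplies it by `e^{-τ H} = f`.
  have hXh : SemiconjBy (expTrunc n (-(H * D'))) h (f * h) := by
    have h1 : SemiconjBy h (-(H * D') + -H) (-(H * D')) := by
      rw [Ring.lie_def, sub_eq_iff_eq_add] at hDh
      rw [SemiconjBy, neg_mul, mul_assoc, hDh, mul_add, mul_add, mul_neg, mul_neg, ← mul_assoc,
        ← mul_assoc, hHh.eq]
      abel
    have h2 := (h1.expTrunc (n := n)).eq
    rw [expTrunc_add hn ((Commute.mul_left (Commute.refl H) hHD'.symm).neg_left.neg_right)] at h2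
    have h3 : Commute (expTrunc n (-(H * D'))) f :=
      (Commute.mul_left (Commute.refl H) hHD'.symm).neg_left.neg_right.symm.expTrunc.symm.expTrunc
    rw [SemiconjBy, ← h2, h3.eq, ← mul_assoc, hfh.eq]
  have hXc : Commute (expTrunc n (-(H * D'))) c := (hcH.mul_right hcD').neg_right.expTrunc.symm
  -- With `X = e^{-τ H D'}` this is `X (1 + τ h) ^ c = (1 + τ f h) ^ c X`, so both sides become `(1
  -- + τ h) ^ D (1 + τ f h) ^ c X`.
  have := (SemiconjBy.binomTrunc (n := n) hXc hXh).eq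
  rw [expTrunc_mul_eq_binomTrunc hn (hDH'.add_left (hcH'.mul_left hfH')),
    expTrunc_mul_eq_binomTrunc hn hDH', expTrunc_mul_eq_binomTrunc hn hcH',
    binomTrunc_add_mul hn hcD hcf hDf hch.symm hfh.symm, mul_assoc, mul_assoc, this]

end Binomial

attribute [local instance] LieRing.ofAssociativeRing

lemma commute_of_lie {A : Type*} [Ring A] {a b : A} (h : ⁅a, b⁆ = 0) : Commute a b := by
  rwa [Ring.lie_def, sub_eq_zero] at h

/-! ### The defining relations and their reduction to undeformed brackets. -/

section Relations

variable {A : Type*} [Ring A] [Algebra ℝ⟦X⟧ A] {n : ℕ}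

/-- The defining relations of `U_τ(sl(2,ℝ))` modulo `τ ^ n`. -/
structure IsSl2 (n : ℕ) (H D C₁ : A) : Prop where
  tau_pow : algebraMap ℝ⟦X⟧ A (τ ^ n) = 0
  DH : ⁅D, H⁆ = -expSubOneDivTrunc n (-H)
  DC₁ : ⁅D, C₁⁆ = -C₁ + τ • D ^ 2
  HC₁ : ⁅H, C₁⁆ = -(2 * D)

/-- The defining relations of `U_τ(so(2,2))` modulo `τ ^ n`. -/
structure IsSo22 (n : ℕ) (H P K D C₁ C₂ : A) : Prop extends IsSl2 n H D C₁ where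
  KH : ⁅K, H⁆ = expTrunc n (-H) * P
  KP : ⁅K, P⁆ = expSubOneDivTrunc n H
  HP : ⁅H, P⁆ = 0
  DP : ⁅D, P⁆ = P
  DC₂ : ⁅D, C₂⁆ = -C₂
  PC₂ : ⁅P, C₂⁆ = 2 * D
  KC₁ : ⁅K, C₁⁆ = C₂
  KC₂ : ⁅K, C₂⁆ = C₁ - τ • D ^ 2
  C₁C₂ : ⁅C₁, C₂⁆ = -(τ • (D * C₂ + C₂ * D))
  HC₂ : ⁅H, C₂⁆ = expTrunc n (-H) * K + K * expTrunc n (-H)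
  PC₁ : ⁅P, C₁⁆ = -(2 * K) - τ • (D * P + P * D)
  KD : ⁅K, D⁆ = 0

lemma commute_neg_expSubOneDivTrunc_neg (H : A) : Commute H (-expSubOneDivTrunc n (-H)) :=
  (Commute.refl H).neg_right.expSubOneDivTrunc.neg_right

lemma alg_lie_smul (r : ℝ⟦X⟧) (a b : A) : ⁅a, r • b⁆ = r • ⁅a, b⁆ := by
  simp only [Ring.lie_def, mul_smul_comm, smul_mul_assoc, smul_sub]

lemma alg_smul_lie (r : ℝ⟦X⟧) (a b : A) : ⁅r • a, b⁆ = r • ⁅a, b⁆ := by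
  simp only [Ring.lie_def, mul_smul_comm, smul_mul_assoc, smul_sub]

namespace IsSl2

variable {H D C₁ : A} (h : IsSl2 n H D C₁)
include h

lemma tau_smul_lie : τ • expSubOneDivTrunc n (-H) = expTrunc n (-H) - 1 :=
  tau_smul_expSubOneDivTrunc h.tau_pow _

lemma lie_D_expTrunc_neg : ⁅D, expTrunc n (-H)⁆ = -expTrunc n (-H) + expTrunc n (-H) ^ 2 := by
  have h1 : ⁅D, -H⁆ = expSubOneDivTrunc n (-H) := by rw [lie_neg, h.DH, neg_neg]
  rw [lie_expTrunc h.tau_pow h1 (Commute.refl _).expSubOneDivTrunc, ← smul_mul_assoc,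
    h.tau_smul_lie]
  noncomm_ring

/-- So `(e^{τ H} - 1) / τ` has weight one under `D`, as `H` has in the undeformed algebra. -/
lemma lie_D_expSubOneDivTrunc : ⁅D, expSubOneDivTrunc n H⁆ = expSubOneDivTrunc n H := by
  rw [lie_expSubOneDivTrunc h.DH (commute_neg_expSubOneDivTrunc_neg H),
    expSubOneDivTrunc_neg h.tau_pow, neg_neg, mul_assoc,
    (Commute.refl H).expSubOneDivTrunc.symm.expTrunc.eq, ← mul_assoc,
    expTrunc_neg_mul h.tau_pow, one_mul]

/-- `C₁ - τ D ^ 2` has the undeformed commutator with `D`. -/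
lemma lie_D_sub : ⁅D, C₁ - τ • D ^ 2⁆ = -(C₁ - τ • D ^ 2) := by
  have : ⁅D, τ • D ^ 2⁆ = 0 := by
    rw [alg_lie_smul, Ring.lie_def, pow_two, mul_assoc, sub_self, smul_zero]
  rw [lie_sub, h.DC₁, this]
  abel

/-- The series of iterated commutators of `-H` on `C₁` stops after second order: `C₁ ↦ 2 D ↦ 2 [D,
H]`, and `[D, H]` is a function of `H`. -/
lemma lie_expTrunc_C₁ : ⁅expTrunc n (-H), C₁⁆ =
    τ • (2 * expTrunc n (-H) * D - expTrunc n (-H) + expTrunc n (-H) ^ 2) := by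
  have key := expTrunc_mul_of_lie (n := n) h.tau_pow (a := -H) (b := C₁) (b' := 2 * D)
    (b'' := -expSubOneDivTrunc n (-H)) (by rw [neg_lie, h.HC₁, neg_neg])
    (by
      rw [← h.DH, Ring.lie_def, Ring.lie_def]
      noncomm_ring) (commute_neg_expSubOneDivTrunc_neg H).neg_left
  have h2 := h.lie_D_expTrunc_neg
  have h3 := h.tau_smul_lie
  set f := expTrunc n (-H)
  rw [Ring.lie_def, key, pow_two, mul_smul, smul_neg, h3]
  rw [Ring.lie_def, sub_eq_iff_eq_add] at h2
  simp only [add_mul, smul_mul_assoc, mul_assoc, h2]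
  simp only [smul_sub, smul_add, mul_add, sub_mul, mul_neg, neg_sub, smul_neg, pow_two, one_mul,
    two_mul]
  abel

end IsSl2

/-- The relations of `U_τ(so(2,2))` follow from the undeformed relations of `so(2,2)` for
`(e^{τ H} - 1) / τ`, `P`, `K`, `D`, `C₁ - τ D ^ 2`, `C₂` and the commutators with `H`. -/
lemma IsSl2.isSo22 {H P K D C₁ C₂ : A} (h : IsSl2 n H D C₁)
    (KH : ⁅K, H⁆ = expTrunc n (-H) * P) (KP : ⁅K, P⁆ = expSubOneDivTrunc n H)
    (HP : ⁅H, P⁆ = 0) (DP : ⁅D, P⁆ = P) (DC₂ : ⁅D, C₂⁆ = -C₂) (PC₂ : ⁅P, C₂⁆ = 2 * D)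
    (KC₁ : ⁅K, C₁ - τ • D ^ 2⁆ = C₂) (KC₂ : ⁅K, C₂⁆ = C₁ - τ • D ^ 2)
    (C₁C₂ : ⁅C₁ - τ • D ^ 2, C₂⁆ = 0) (PC₁ : ⁅P, C₁ - τ • D ^ 2⁆ = -(2 * K)) (KD : ⁅K, D⁆ = 0) :
    IsSo22 n H P K D C₁ C₂ := by
  have hKD : K * D = D * K := by simpa [Ring.lie_def, sub_eq_zero] using KD
  have KC₁' : ⁅K, C₁⁆ = C₂ := by
    rw [← KC₁, lie_sub, alg_lie_smul]
    have : ⁅K, D ^ 2⁆ = 0 := by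
      rw [Ring.lie_def, pow_two, ← mul_assoc, hKD, mul_assoc, hKD, mul_assoc, sub_self]
    rw [this, smul_zero, sub_zero]
  have PC₁' : ⁅P, C₁⁆ = -(2 * K) - τ • (D * P + P * D) := by
    rw [← PC₁, lie_sub, alg_lie_smul]
    have : ⁅P, D ^ 2⁆ = -(D * P + P * D) := by
      have hP : P = D * P - P * D := by rw [← Ring.lie_def, DP]
      have : ⁅P, D ^ 2⁆ = -(D * (D * P - P * D) + (D * P - P * D) * D) := by
        rw [Ring.lie_def]; noncomm_ring
      rw [this, ← hP]
    rw [this, smul_neg]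
    abel
  have C₁C₂' : ⁅C₁, C₂⁆ = -(τ • (D * C₂ + C₂ * D)) := by
    rw [sub_lie, sub_eq_zero] at C₁C₂
    rw [C₁C₂, alg_smul_lie, ← smul_neg]
    congr 1
    have hC : -C₂ = D * C₂ - C₂ * D := by rw [← Ring.lie_def, DC₂]
    have : ⁅D ^ 2, C₂⁆ = D * (D * C₂ - C₂ * D) + (D * C₂ - C₂ * D) * D := by
      rw [Ring.lie_def]; noncomm_ring
    rw [this, ← hC]
    noncomm_ring
  have HC₂ : ⁅H, C₂⁆ = expTrunc n (-H) * K + K * expTrunc n (-H) := by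
    have hHf : Commute H (expTrunc n (-H)) := (Commute.refl H).neg_right.expTrunc
    have hKf : ⁅K, expTrunc n (-H)⁆ = -τ • (expTrunc n (-H) ^ 2 * P) := by
      have hPf : Commute P (expTrunc n (-H)) := (commute_of_lie HP).symm.neg_right.expTrunc
      have hc : Commute (-H) (-(expTrunc n (-H) * P)) :=
        (hHf.mul_right (commute_of_lie HP)).neg_right.neg_left
      rw [lie_expTrunc h.tau_pow (by rw [lie_neg, KH]) hc, neg_mul, mul_assoc, hPf.eq, ← mul_assoc,
        ← pow_two, smul_neg, neg_smul]
    have hfC := h.lie_expTrunc_C₁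
    set f := expTrunc n (-H)
    -- Jacobi applied to `C₂ = [K, C₁]`; the term `[K, [H, C₁]] = -2 [K, D]` drops out.
    have h1 : ⁅H, C₂⁆ = -(f * ⁅P, C₁⁆ + ⁅f, C₁⁆ * P) := by
      have e1 : ⁅H, ⁅K, C₁⁆⁆ = ⁅⁅H, K⁆, C₁⁆ + ⁅K, ⁅H, C₁⁆⁆ := leibniz_lie _ _ _
      have e2 : ⁅K, -(2 * D)⁆ = 0 := by
        rw [Ring.lie_def]
        simp only [two_mul, mul_neg, neg_mul, mul_add, add_mul, hKD, sub_self]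
      rw [← KC₁', e1, h.HC₁, e2, add_zero, ← lie_skew H K, KH, neg_lie]
      congr 1
      simp only [Ring.lie_def]
      noncomm_ring
    have hKf' : K * f = f * K - τ • (f ^ 2 * P) := by
      rw [Ring.lie_def, sub_eq_iff_eq_add] at hKf
      rw [hKf, neg_smul]; abel
    have hDP : D * P = P + P * D := by
      rw [Ring.lie_def, sub_eq_iff_eq_add] at DP
      exact DP
    rw [h1, PC₁', hfC, hKf']
    simp only [smul_add, smul_sub, add_mul, sub_mul, mul_add, mul_sub, smul_mul_assoc,
      mul_smul_comm, two_mul, mul_neg, neg_add, neg_sub, mul_assoc, hDP]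
    abel
  exact { h with KH, KP, HP, DP, DC₂, PC₂, KC₁ := KC₁', KC₂, C₁C₂ := C₁C₂', HC₂, PC₁ := PC₁', KD }

namespace IsSo22

variable {H P K D C₁ C₂ : A} (h : IsSo22 n H P K D C₁ C₂)
include h

lemma lie_K_sub : ⁅K, C₁ - τ • D ^ 2⁆ = C₂ := by
  have : Commute K (D ^ 2) := (commute_of_lie h.KD).pow_right 2
  rw [lie_sub, alg_lie_smul, h.KC₁, Ring.lie_def K, this.eq, sub_self, smul_zero, sub_zero]

lemma lie_P_sub : ⁅P, C₁ - τ • D ^ 2⁆ = -(2 * K) := by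
  have hP : P = D * P - P * D := by rw [← Ring.lie_def, h.DP]
  have : ⁅P, D ^ 2⁆ = -(D * (D * P - P * D) + (D * P - P * D) * D) := by
    rw [Ring.lie_def]; noncomm_ring
  rw [lie_sub, alg_lie_smul, h.PC₁, this, ← hP, smul_neg]
  abel

lemma lie_sub_C₂ : ⁅C₁ - τ • D ^ 2, C₂⁆ = 0 := by
  have hC : -C₂ = D * C₂ - C₂ * D := by rw [← Ring.lie_def, h.DC₂]
  have : ⁅D ^ 2, C₂⁆ = D * (D * C₂ - C₂ * D) + (D * C₂ - C₂ * D) * D := by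
    rw [Ring.lie_def]; noncomm_ring
  rw [sub_lie, alg_smul_lie, h.C₁C₂, this, ← hC, ← smul_neg, ← smul_sub]
  convert smul_zero _
  noncomm_ring

end IsSo22

end Relations

/-! ### Conjugation by an exponential. -/

section Twist

variable {B : Type*} [Ring B] [Algebra ℝ⟦X⟧ B] {n : ℕ}

/-- Conjugation by `e^{τ a}`. -/
def conjExp (hn : algebraMap ℝ⟦X⟧ B (τ ^ n) = 0) (a : B) : B →ₐ[ℝ⟦X⟧] B where
  toFun b := expTrunc n a * b * expTrunc n (-a)
  map_one' := by rw [mul_one, expTrunc_mul_neg hn]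
  map_mul' b c := by
    calc expTrunc n a * (b * c) * expTrunc n (-a)
        = expTrunc n a * b * 1 * c * expTrunc n (-a) := by simp only [mul_one, mul_assoc]
      _ = _ := by rw [← expTrunc_neg_mul hn a]; simp only [mul_assoc]
  map_zero' := by simp
  map_add' b c := by rw [mul_add, add_mul]
  commutes' r := by
    rw [← Algebra.commutes, mul_assoc, expTrunc_mul_neg hn, mul_one]

lemma conjExp_apply (hn : algebraMap ℝ⟦X⟧ B (τ ^ n) = 0) (a b : B) :
    conjExp hn a b = expTrunc n a * b * expTrunc n (-a) := rfl

lemma conjExp_neg_conjExp (hn : algebraMap ℝ⟦X⟧ B (τ ^ n) = 0) (a b : B) :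
    conjExp hn (-a) (conjExp hn a b) = b := by
  rw [conjExp_apply, conjExp_apply, neg_neg, mul_assoc (expTrunc n a), ← mul_assoc,
    expTrunc_neg_mul hn, one_mul, mul_assoc, expTrunc_neg_mul hn, mul_one]

lemma conjExp_of_mul_eq (hn : algebraMap ℝ⟦X⟧ B (τ ^ n) = 0) {a b c : B}
    (h : expTrunc n a * b = c * expTrunc n a) : conjExp hn a b = c := by
  rw [conjExp_apply, h, mul_assoc, expTrunc_mul_neg hn, mul_one]

lemma conjExp_of_lie (hn : algebraMap ℝ⟦X⟧ B (τ ^ n) = 0) {a b b' b'' : B}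
    (h : ⁅a, b⁆ = b') (h' : ⁅a, b'⁆ = 2 * b'') (h'' : Commute a b'') :
    conjExp hn a b = b + τ • b' + τ ^ 2 • b'' :=
  conjExp_of_mul_eq hn (expTrunc_mul_of_lie hn h h' h'')

lemma conjExp_of_lie_commute (hn : algebraMap ℝ⟦X⟧ B (τ ^ n) = 0) {a b b' : B}
    (h : ⁅a, b⁆ = b') (h' : Commute a b') : conjExp hn a b = b + τ • b' :=
  conjExp_of_mul_eq hn (expTrunc_mul_of_lie_commute hn h h')

lemma conjExp_of_commute (hn : algebraMap ℝ⟦X⟧ B (τ ^ n) = 0) {a b : B} (h : Commute a b) :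
    conjExp hn a b = b :=
  conjExp_of_mul_eq hn h.symm.expTrunc.symm

/-- Here `a b = b (a + c)`, hence `e^{τ a} b = b e^{τ (a + c)}`. -/
lemma conjExp_of_shift (hn : algebraMap ℝ⟦X⟧ B (τ ^ n) = 0) {a b c : B}
    (h : ⁅a, b⁆ = b * c) (hc : Commute a c) : conjExp hn a b = b * expTrunc n c := by
  refine conjExp_of_mul_eq hn ?_
  have h1 : SemiconjBy b (a + c) a := by
    rw [SemiconjBy, mul_add, ← h, Ring.lie_def]; abel
  rw [← h1.expTrunc.eq, add_comm, expTrunc_add hn hc.symm, mul_assoc]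

end Twist

/-! ### The coproduct as the twist of the primitive one. -/

section Coproduct

variable {A : Type*} [Ring A] [Algebra ℝ⟦X⟧ A] {n : ℕ}

local notation "T2" => A ⊗[ℝ⟦X⟧] A

lemma tau_pow_tensor (hn : algebraMap ℝ⟦X⟧ A (τ ^ n) = 0) :
    algebraMap ℝ⟦X⟧ T2 (τ ^ n) = 0 := by
  rw [Algebra.TensorProduct.algebraMap_apply, hn, TensorProduct.zero_tmul]

lemma expTrunc_one_tmul (a : A) : expTrunc n (1 ⊗ₜ a : T2) = 1 ⊗ₜ expTrunc n a :=
  (map_expTrunc Algebra.TensorProduct.includeRight n a).symm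

lemma expTrunc_tmul_one (a : A) : expTrunc n (a ⊗ₜ 1 : T2) = expTrunc n a ⊗ₜ 1 :=
  (map_expTrunc (Algebra.TensorProduct.includeLeft : A →ₐ[ℝ⟦X⟧] T2) n a).symm

lemma expSubOneDivTrunc_one_tmul (a : A) :
    expSubOneDivTrunc n (1 ⊗ₜ a : T2) = 1 ⊗ₜ expSubOneDivTrunc n a :=
  (map_expSubOneDivTrunc Algebra.TensorProduct.includeRight n a).symm

lemma expSubOneDivTrunc_tmul_one (a : A) :
    expSubOneDivTrunc n (a ⊗ₜ 1 : T2) = expSubOneDivTrunc n a ⊗ₜ 1 :=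
  (map_expSubOneDivTrunc (Algebra.TensorProduct.includeLeft : A →ₐ[ℝ⟦X⟧] T2) n a).symm

lemma commute_tmul {a b c d : A} (h : Commute a c) (h' : Commute b d) :
    Commute (a ⊗ₜ b : T2) (c ⊗ₜ d) := by
  rw [Commute, SemiconjBy, Algebra.TensorProduct.tmul_mul_tmul,
    Algebra.TensorProduct.tmul_mul_tmul, h.eq, h'.eq]

lemma lie_tmul_of_commute_right {a b c d : A} (h : Commute b d) :
    ⁅a ⊗ₜ[ℝ⟦X⟧] b, c ⊗ₜ[ℝ⟦X⟧] d⁆ = ⁅a, c⁆ ⊗ₜ[ℝ⟦X⟧] (b * d) := by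
  rw [Ring.lie_def, Ring.lie_def, Algebra.TensorProduct.tmul_mul_tmul,
    Algebra.TensorProduct.tmul_mul_tmul, ← h.eq, TensorProduct.sub_tmul]

lemma lie_tmul_of_commute_left {a b c d : A} (h : Commute a c) :
    ⁅a ⊗ₜ[ℝ⟦X⟧] b, c ⊗ₜ[ℝ⟦X⟧] d⁆ = (a * c) ⊗ₜ[ℝ⟦X⟧] ⁅b, d⁆ := by
  rw [Ring.lie_def, Ring.lie_def, Algebra.TensorProduct.tmul_mul_tmul,
    Algebra.TensorProduct.tmul_mul_tmul, ← h.eq, TensorProduct.tmul_sub]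

/-- The primitive element `a ⊗ 1 + 1 ⊗ a`. -/
def prim (a : A) : T2 := a ⊗ₜ 1 + 1 ⊗ₜ a

lemma prim_neg (a : A) : prim (-a) = -prim a := by
  simp only [prim, TensorProduct.neg_tmul, TensorProduct.tmul_neg]; abel

lemma prim_two_mul (a : A) : prim (2 * a) = 2 * prim a := by
  simp only [prim, two_mul, TensorProduct.add_tmul, TensorProduct.tmul_add]; abel

lemma lie_prim (a b : A) : ⁅prim a, prim b⁆ = prim ⁅a, b⁆ := by
  simp only [prim, lie_add, add_lie]
  rw [lie_tmul_of_commute_right (Commute.one_left (1 : A)),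
    lie_tmul_of_commute_right (Commute.one_left b), lie_tmul_of_commute_right (Commute.one_right a),
    lie_tmul_of_commute_left (Commute.one_left (1 : A))]
  simp [Ring.lie_def]

lemma comm_prim (a : A) : Algebra.TensorProduct.comm ℝ⟦X⟧ A A (prim a) = prim a := by
  simp [prim, add_comm]

section Values

variable (n) (H P K D C₁ C₂ : A)

/-- `1 ⊗ H + H ⊗ 1` -/
def coprodH : T2 := 1 ⊗ₜ H + H ⊗ₜ 1

/-- `1 ⊗ P + P ⊗ e^{τ H}` -/
def coprodP : T2 := 1 ⊗ₜ P + P ⊗ₜ expTrunc n H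

/-- `1 ⊗ D + D ⊗ e^{-τ H}`, the coproduct of `D` and `C₁` -/
def coprodD : T2 := 1 ⊗ₜ D + D ⊗ₜ expTrunc n (-H)

/-- `1 ⊗ K + K ⊗ 1 - τ D ⊗ e^{-τ H} P` -/
def coprodK : T2 := 1 ⊗ₜ K + K ⊗ₜ 1 - τ • D ⊗ₜ (expTrunc n (-H) * P)

/-- `1 ⊗ C₂ + C₂ ⊗ e^{-τ H} + 2 τ D ⊗ e^{-τ H} K - τ ^ 2 D (D + 1) ⊗ e^{-2 τ H} P` -/
def coprodC₂ : T2 := 1 ⊗ₜ C₂ + C₂ ⊗ₜ expTrunc n (-H)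
  + (2 * τ) • D ⊗ₜ (expTrunc n (-H) * K)
  - τ ^ 2 • (D * (D + 1)) ⊗ₜ (expTrunc n (-H) ^ 2 * P)

end Values

lemma neg_coprodH (H : A) : -coprodH H = coprodH (-H) := by
  simp [coprodH, TensorProduct.neg_tmul, TensorProduct.tmul_neg, add_comm]

lemma expTrunc_coprodH (hn : algebraMap ℝ⟦X⟧ A (τ ^ n) = 0) (H : A) :
    expTrunc n (coprodH H) = expTrunc n H ⊗ₜ expTrunc n H := by
  rw [coprodH,
    expTrunc_add (tau_pow_tensor hn) (commute_tmul (Commute.one_left _) (Commute.one_right _)),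
    expTrunc_one_tmul, expTrunc_tmul_one, Algebra.TensorProduct.tmul_mul_tmul, mul_one, one_mul]

lemma expSubOneDivTrunc_coprodH (hn : algebraMap ℝ⟦X⟧ A (τ ^ n) = 0) (H : A) :
    expSubOneDivTrunc n (coprodH H) =
      1 ⊗ₜ expSubOneDivTrunc n H + expSubOneDivTrunc n H ⊗ₜ expTrunc n H := by
  rw [coprodH, expSubOneDivTrunc_add (tau_pow_tensor hn)
      (commute_tmul (Commute.one_left _) (Commute.one_right _)),
    expTrunc_one_tmul, expSubOneDivTrunc_one_tmul, expSubOneDivTrunc_tmul_one,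
    Algebra.TensorProduct.tmul_mul_tmul, mul_one, one_mul]

namespace IsSl2

variable {H D C₁ : A} (h : IsSl2 n H D C₁)
include h

/-- Conjugation by `e^{τ D ⊗ H}`, the twist. -/
local notation "Ψ" => conjExp (tau_pow_tensor h.tau_pow) (D ⊗ₜ[ℝ⟦X⟧] H)

lemma lie_H_D : ⁅H, D⁆ = expSubOneDivTrunc n (-H) := by
  rw [← lie_skew, h.DH, neg_neg]

/-- Only `1 ⊗ D` moves, and only to first order: `τ D ⊗ [H, D] = D ⊗ (e^{-τ H} - 1)`. -/
lemma twist_prim_D : Ψ (prim D) = coprodD n H D := by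
  have h1 := conjExp_of_commute (tau_pow_tensor h.tau_pow)
    (commute_tmul (Commute.refl D) (Commute.one_right H))
  have h2 := conjExp_of_lie_commute (tau_pow_tensor h.tau_pow) (a := D ⊗ₜ H) (b := 1 ⊗ₜ D)
    (b' := D ⊗ₜ expSubOneDivTrunc n (-H))
    (by rw [lie_tmul_of_commute_left (Commute.one_right D), h.lie_H_D, mul_one])
    (commute_tmul (Commute.refl D) (Commute.refl H).neg_right.expSubOneDivTrunc)
  rw [prim, map_add, h1, h2, ← TensorProduct.tmul_smul, h.tau_smul_lie, TensorProduct.tmul_sub,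
    coprodD]
  abel

/-- An element of weight `s` under `D` is multiplied by `e^{s τ H}` in the second factor. -/
lemma twist_tmul_one_of_weight {a : A} {s : ℤ} (ha : ⁅D, a⁆ = s • a) :
    Ψ (a ⊗ₜ 1) = a ⊗ₜ expTrunc n (s • H) := by
  rw [conjExp_of_shift (c := 1 ⊗ₜ (s • H)), expTrunc_one_tmul,
    Algebra.TensorProduct.tmul_mul_tmul, mul_one, one_mul]
  · rw [lie_tmul_of_commute_right (Commute.one_right H), ha,
      Algebra.TensorProduct.tmul_mul_tmul, mul_one, mul_one, one_mul, TensorProduct.smul_tmul]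
  · exact commute_tmul (Commute.one_right D) (Commute.smul_right (Commute.refl H) s)

lemma twist_prim_expSubOneDivTrunc :
    Ψ (prim (expSubOneDivTrunc n H)) = expSubOneDivTrunc n (coprodH H) := by
  have h1 := h.twist_tmul_one_of_weight (a := expSubOneDivTrunc n H) (s := 1)
    (by rw [h.lie_D_expSubOneDivTrunc, one_smul])
  have h2 := conjExp_of_commute (tau_pow_tensor h.tau_pow)
    (commute_tmul (Commute.one_right D) (Commute.expSubOneDivTrunc (n := n) (Commute.refl H)))
  rw [prim, map_add, h1, h2, expSubOneDivTrunc_coprodH h.tau_pow, one_smul, add_comm]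

lemma twist_prim_C₁ : Ψ (prim (C₁ - τ • D ^ 2)) = coprodD n H C₁ - τ • coprodD n H D ^ 2 := by
  have h1 := h.twist_tmul_one_of_weight (a := C₁ - τ • D ^ 2) (s := -1)
    (by rw [h.lie_D_sub, neg_one_smul])
  -- The second commutator of `D ⊗ H` with `1 ⊗ C₁` is `-2 D ^ 2 ⊗ [H, D]`, which commutes with `D ⊗
  -- H`.
  have h2 := conjExp_of_lie (tau_pow_tensor h.tau_pow) (a := D ⊗ₜ H) (b := 1 ⊗ₜ C₁)
    (b' := D ⊗ₜ (-(2 * D))) (b'' := -((D * D) ⊗ₜ expSubOneDivTrunc n (-H)))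
    (by rw [lie_tmul_of_commute_left (Commute.one_right D), h.HC₁, mul_one])
    (by
      rw [lie_tmul_of_commute_left (Commute.refl D), lie_neg, two_mul, lie_add, h.lie_H_D,
        TensorProduct.tmul_neg, TensorProduct.tmul_add]
      noncomm_ring)
    (commute_tmul ((Commute.refl D).mul_right (Commute.refl D))
      (Commute.refl H).neg_right.expSubOneDivTrunc).neg_right
  have h3 : Ψ (1 ⊗ₜ D) = coprodD n H D - D ⊗ₜ 1 := by
    rw [← h.twist_prim_D, prim, map_add,
      conjExp_of_commute _ (commute_tmul (Commute.refl D) (Commute.one_right H))]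
    abel
  have h4 : (1 ⊗ₜ[ℝ⟦X⟧] (C₁ - τ • D ^ 2) : T2) = 1 ⊗ₜ C₁ - τ • (1 ⊗ₜ D) ^ 2 := by
    rw [TensorProduct.tmul_sub, TensorProduct.tmul_smul, Algebra.TensorProduct.tmul_pow, one_pow]
  rw [prim, map_add, h1, neg_one_smul, h4, map_sub, map_smul, map_pow, h2, h3]
  have h5 : τ ^ 2 • -((D * D) ⊗ₜ[ℝ⟦X⟧] expSubOneDivTrunc n (-H)) =
      -(τ • ((D * D) ⊗ₜ[ℝ⟦X⟧] (expTrunc n (-H) - 1))) := by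
    rw [← h.tau_smul_lie, TensorProduct.tmul_smul, smul_neg, pow_two, mul_smul]
  rw [h5, coprodD, coprodD]
  set f := expTrunc n (-H)
  simp only [pow_two, mul_add, add_mul, mul_sub, sub_mul, Algebra.TensorProduct.tmul_mul_tmul,
    mul_one, one_mul, two_mul, TensorProduct.sub_tmul, TensorProduct.tmul_sub, smul_sub, smul_add,
    TensorProduct.tmul_add, TensorProduct.tmul_neg, TensorProduct.smul_tmul',
    smul_neg]
  abel

lemma lie_coprodD_coprodH : ⁅coprodD n H D, coprodH H⁆ = -expSubOneDivTrunc n (-coprodH H) := by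
  have hf : Commute (expTrunc n (-H)) H := (Commute.refl H).neg_right.expTrunc.symm
  rw [neg_coprodH, expSubOneDivTrunc_coprodH h.tau_pow, coprodD, coprodH]
  simp only [lie_add, add_lie]
  rw [lie_tmul_of_commute_left (Commute.one_left (1 : A)),
    lie_tmul_of_commute_left (Commute.one_left H),
    lie_tmul_of_commute_right (a := D) (c := 1) hf,
    lie_tmul_of_commute_right (Commute.one_right _), h.DH]
  simp [Ring.lie_def, TensorProduct.neg_tmul, TensorProduct.tmul_neg]
  abel

lemma coproduct : IsSl2 n (coprodH H) (coprodD n H D) (coprodD n H C₁) where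
  tau_pow := tau_pow_tensor h.tau_pow
  DH := h.lie_coprodD_coprodH
  DC₁ := by
    -- `[D, C₁ - τ D ^ 2]` is undeformed and is transported by `Ψ`; the square of the coproduct of
    -- `D` then drops out of the bracket.
    have h1 : ⁅coprodD n H D, coprodD n H C₁ - τ • coprodD n H D ^ 2⁆ =
        -(coprodD n H C₁ - τ • coprodD n H D ^ 2) := by
      rw [← h.twist_prim_C₁, ← h.twist_prim_D, Ring.lie_def, ← map_mul, ← map_mul, ← map_sub,
        ← Ring.lie_def, lie_prim, h.lie_D_sub, prim_neg, map_neg]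
    rw [lie_sub, alg_lie_smul, Ring.lie_def _ (_ ^ 2), ((Commute.refl _).pow_right 2).eq, sub_self,
      smul_zero, sub_zero] at h1
    rw [h1]
    abel
  HC₁ := by
    have hf : Commute H (expTrunc n (-H)) := (Commute.refl H).neg_right.expTrunc
    rw [coprodD, coprodD, coprodH]
    simp only [lie_add, add_lie]
    rw [lie_tmul_of_commute_left (Commute.one_left (1 : A)),
      lie_tmul_of_commute_left (Commute.one_left C₁),
      lie_tmul_of_commute_right (a := H) (c := 1) (Commute.one_left _),
      lie_tmul_of_commute_right (Commute.one_left _), h.HC₁, Ring.lie_def _ (expTrunc n (-H)),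
      hf.eq]
    simp [Ring.lie_def, TensorProduct.neg_tmul, TensorProduct.tmul_neg, two_mul,
      TensorProduct.tmul_add, TensorProduct.add_tmul]
    abel

end IsSl2

namespace IsSo22

variable {H P K D C₁ C₂ : A} (h : IsSo22 n H P K D C₁ C₂)
include h

local notation "Ψ" => conjExp (tau_pow_tensor h.tau_pow) (D ⊗ₜ[ℝ⟦X⟧] H)

lemma lie_H_K : ⁅H, K⁆ = -(expTrunc n (-H) * P) := by rw [← lie_skew, h.KH]

lemma commute_H_expTrunc_mul_P : Commute H (expTrunc n (-H) * P) :=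
  (Commute.refl H).neg_right.expTrunc.mul_right (commute_of_lie h.HP)

lemma lie_K_expTrunc : ⁅K, expTrunc n (-H)⁆ = -(τ • (expTrunc n (-H) ^ 2 * P)) := by
  have hPf : Commute P (expTrunc n (-H)) := (commute_of_lie h.HP).symm.neg_right.expTrunc
  rw [lie_expTrunc h.tau_pow (by rw [lie_neg, h.KH])
    h.commute_H_expTrunc_mul_P.neg_right.neg_left, neg_mul, mul_assoc, hPf.eq, ← mul_assoc,
    ← pow_two, smul_neg]

lemma twist_prim_P : Ψ (prim P) = coprodP n H P := by
  have h1 := h.twist_tmul_one_of_weight (a := P) (s := 1) (by rw [h.DP, one_smul])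
  have h2 := conjExp_of_commute (tau_pow_tensor h.tau_pow)
    (commute_tmul (Commute.one_right D) (commute_of_lie h.HP))
  rw [prim, map_add, h1, h2, one_smul, add_comm, coprodP]

lemma twist_one_tmul_K :
    Ψ (1 ⊗ₜ K) = 1 ⊗ₜ K - τ • D ⊗ₜ (expTrunc n (-H) * P) := by
  rw [conjExp_of_lie_commute (tau_pow_tensor h.tau_pow) (a := D ⊗ₜ H) (b := 1 ⊗ₜ K)
    (b' := -(D ⊗ₜ (expTrunc n (-H) * P))), smul_neg, sub_eq_add_neg]
  · rw [lie_tmul_of_commute_left (Commute.one_right D), h.lie_H_K, mul_one, TensorProduct.tmul_neg]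
  · exact (commute_tmul (Commute.refl D) h.commute_H_expTrunc_mul_P).neg_right

lemma twist_prim_K : Ψ (prim K) = coprodK n H P K D := by
  have h1 := conjExp_of_commute (tau_pow_tensor h.tau_pow)
    (commute_tmul (commute_of_lie h.KD).symm (Commute.one_right H))
  rw [prim, map_add, h1, h.twist_one_tmul_K, coprodK]
  abel

lemma twist_prim_C₂ : Ψ (prim C₂) = coprodC₂ n H P K D C₂ := by
  have hHf : Commute H (expTrunc n (-H)) := (Commute.refl H).neg_right.expTrunc
  have h1 := h.twist_tmul_one_of_weight (a := C₂) (s := -1) (by rw [h.DC₂, neg_one_smul])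
  -- With `K` moved to the right of `e^{-τ H}`, a further commutator with `H` yields only functions
  -- of `H` times `P`, so the expansion stops at second order.
  have h2 : ⁅H, C₂⁆ = 2 * (expTrunc n (-H) * K) - τ • (expTrunc n (-H) ^ 2 * P) := by
    have := h.lie_K_expTrunc
    rw [Ring.lie_def, sub_eq_iff_eq_add] at this
    rw [h.HC₂, this, two_mul]
    abel
  have h3 : ⁅H, expTrunc n (-H) * K⁆ = -(expTrunc n (-H) ^ 2 * P) := by
    have : ⁅H, expTrunc n (-H) * K⁆ = expTrunc n (-H) * ⁅H, K⁆ := by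
      rw [Ring.lie_def, Ring.lie_def, ← mul_assoc, hHf.eq]; noncomm_ring
    rw [this, h.lie_H_K]; noncomm_ring
  have h4 : Commute H (expTrunc n (-H) ^ 2 * P) :=
    (hHf.pow_right 2).mul_right (commute_of_lie h.HP)
  have h5 := conjExp_of_lie (tau_pow_tensor h.tau_pow) (a := D ⊗ₜ H) (b := 1 ⊗ₜ C₂)
    (b' := D ⊗ₜ (2 * (expTrunc n (-H) * K) - τ • (expTrunc n (-H) ^ 2 * P)))
    (b'' := -((D * D) ⊗ₜ (expTrunc n (-H) ^ 2 * P)))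
    (by rw [lie_tmul_of_commute_left (Commute.one_right D), h2, mul_one])
    (by
      rw [lie_tmul_of_commute_left (Commute.refl D), lie_sub, two_mul, lie_add, h3, alg_lie_smul,
        Ring.lie_def, h4.eq, sub_self, smul_zero, sub_zero, TensorProduct.tmul_add,
        TensorProduct.tmul_neg]
      noncomm_ring)
    (commute_tmul ((Commute.refl D).mul_right (Commute.refl D)) h4).neg_right
  rw [prim, map_add, h1, h5, coprodC₂, neg_one_smul]
  simp only [TensorProduct.tmul_sub, two_mul, TensorProduct.tmul_add, mul_add, mul_one,
    TensorProduct.add_tmul, smul_add, smul_sub, smul_neg, TensorProduct.tmul_smul, pow_two τ,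
    mul_smul, add_smul]
  abel

/-- All brackets between twisted primitive elements are transported by `Ψ`. The coproduct of `H` is
not obtained in this way, so `[K, H]` and `[H, P]` are computed directly. -/
lemma coproduct : IsSo22 n (coprodH H) (coprodP n H P) (coprodK n H P K D) (coprodD n H D)
    (coprodD n H C₁) (coprodC₂ n H P K D C₂) := by
  have lie_twist (a b : A) : ⁅Ψ (prim a), Ψ (prim b)⁆ = Ψ (prim ⁅a, b⁆) := by
    rw [Ring.lie_def, ← map_mul, ← map_mul, ← map_sub, ← Ring.lie_def, lie_prim]
  have hHf : Commute (expTrunc n (-H)) H := (Commute.refl H).neg_right.expTrunc.symm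
  have hHe : Commute H (expTrunc n H) := (Commute.refl H).expTrunc
  have hHP : Commute H P := commute_of_lie h.HP
  refine h.toIsSl2.coproduct.isSo22 ?_ ?_ ?_ ?_ ?_ ?_ ?_ ?_ ?_ ?_ ?_
  · rw [neg_coprodH, expTrunc_coprodH h.tau_pow]
    have h1 : (τ : ℝ⟦X⟧) • ⁅D, H⁆ = 1 - expTrunc n (-H) := by
      rw [h.DH, smul_neg, h.tau_smul_lie, neg_sub]
    have h2 : ⁅D ⊗ₜ[ℝ⟦X⟧] (expTrunc n (-H) * P), (1 : A) ⊗ₜ[ℝ⟦X⟧] H⁆ = 0 := by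
      rw [Ring.lie_def, sub_eq_zero]
      exact commute_tmul (Commute.one_right D) h.commute_H_expTrunc_mul_P.symm
    simp only [coprodK, coprodH, coprodP, lie_add, add_lie, sub_lie, alg_smul_lie]
    rw [h2, lie_tmul_of_commute_left (Commute.one_left (1 : A)),
      lie_tmul_of_commute_left (Commute.one_left H),
      lie_tmul_of_commute_right (a := K) (c := 1) (Commute.one_left _),
      lie_tmul_of_commute_right (a := K) (Commute.one_right _),
      lie_tmul_of_commute_right (a := D) (Commute.one_right _), h.KH,
      TensorProduct.smul_tmul', h1, mul_add, Algebra.TensorProduct.tmul_mul_tmul,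
      Algebra.TensorProduct.tmul_mul_tmul, expTrunc_neg_mul h.tau_pow]
    simp [Ring.lie_def, TensorProduct.sub_tmul]
    abel
  · rw [← h.twist_prim_K, ← h.twist_prim_P, lie_twist, h.KP, h.twist_prim_expSubOneDivTrunc]
  · rw [Ring.lie_def, sub_eq_zero]
    exact ((commute_tmul (Commute.one_left _) hHP).add_right
      (commute_tmul (Commute.one_left _) hHe)).add_left
      ((commute_tmul (Commute.one_right _) (Commute.one_left _)).add_right
        (commute_tmul hHP (Commute.one_left _)))
  · rw [← h.twist_prim_P, ← h.twist_prim_D, lie_twist, h.DP]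
  · rw [← h.twist_prim_C₂, ← h.twist_prim_D, lie_twist, h.DC₂, prim_neg, map_neg]
  · rw [← h.twist_prim_P, ← h.twist_prim_C₂, lie_twist, h.PC₂, ← h.twist_prim_D, prim_two_mul,
      map_mul, map_ofNat]
  · rw [← h.twist_prim_C₁, ← h.twist_prim_K, lie_twist, h.lie_K_sub, h.twist_prim_C₂]
  · rw [← h.twist_prim_C₁, ← h.twist_prim_K, ← h.twist_prim_C₂, lie_twist, h.KC₂]
  · rw [← h.twist_prim_C₁, ← h.twist_prim_C₂, lie_twist, h.lie_sub_C₂]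
    simp [prim]
  · rw [← h.twist_prim_C₁, ← h.twist_prim_P, lie_twist, h.lie_P_sub, ← h.twist_prim_K, prim_neg,
      prim_two_mul, map_neg, map_mul, map_ofNat]
  · rw [← h.twist_prim_K, ← h.twist_prim_D, lie_twist, h.KD]
    simp [prim]

end IsSo22

end Coproduct

/-! ### The intertwining property and the hexagons modulo `τ ^ n`. -/

section RMatrix

variable {A : Type*} [Ring A] [Algebra ℝ⟦X⟧ A] {n : ℕ}

local notation "T2" => A ⊗[ℝ⟦X⟧] A

local notation "T3" => A ⊗[ℝ⟦X⟧] (A ⊗[ℝ⟦X⟧] A)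

/-- `exp{τ H ⊗ D} exp{-τ D ⊗ H}` modulo `τ ^ n`. -/
def rMatrixTrunc (n : ℕ) (H D : A) : T2 :=
  expTrunc n (H ⊗ₜ D) * expTrunc n (-(D ⊗ₜ H))

/-- An element whose conjugate by the twist is symmetric is intertwined by the R-matrix. -/
lemma rMatrixTrunc_mul (hn : algebraMap ℝ⟦X⟧ A (τ ^ n) = 0) (H D : A) (d : T2)
    (hd : Algebra.TensorProduct.comm ℝ⟦X⟧ A A (conjExp (tau_pow_tensor hn) (-(D ⊗ₜ H)) d) =
      conjExp (tau_pow_tensor hn) (-(D ⊗ₜ H)) d) :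
    rMatrixTrunc n H D * d = Algebra.TensorProduct.comm ℝ⟦X⟧ A A d * rMatrixTrunc n H D := by
  have hc (a : T2) : Algebra.TensorProduct.comm ℝ⟦X⟧ A A (expTrunc n a) =
      expTrunc n (Algebra.TensorProduct.comm ℝ⟦X⟧ A A a) :=
    map_expTrunc (Algebra.TensorProduct.comm ℝ⟦X⟧ A A).toAlgHom n a
  simp only [conjExp_apply, neg_neg, map_mul, hc, map_neg, Algebra.TensorProduct.comm_tmul] at hd
  have h1 := expTrunc_mul_neg (n := n) (tau_pow_tensor hn) (D ⊗ₜ[ℝ⟦X⟧] H)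
  have h2 := expTrunc_mul_neg (n := n) (tau_pow_tensor hn) (H ⊗ₜ[ℝ⟦X⟧] D)
  rw [rMatrixTrunc]
  set σd := Algebra.TensorProduct.comm ℝ⟦X⟧ A A d
  set F := expTrunc n (D ⊗ₜ[ℝ⟦X⟧] H)
  set G := expTrunc n (-(D ⊗ₜ[ℝ⟦X⟧] H))
  set F' := expTrunc n (H ⊗ₜ[ℝ⟦X⟧] D)
  set G' := expTrunc n (-(H ⊗ₜ[ℝ⟦X⟧] D))
  -- The R-matrix is `F' G`, where `F'` is the flip of `F = G⁻¹`; by `hd` the element `G d F` may be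
  -- replaced by its flip `G' σd F'`.
  calc F' * G * d = F' * (G * d * F) * G := by
        simp only [mul_assoc, h1, mul_one]
    _ = (F' * G') * σd * F' * G := by rw [← hd]; simp only [mul_assoc]
    _ = σd * (F' * G) := by rw [h2, one_mul, mul_assoc]

namespace IsSl2

variable {H D C₁ : A} (h : IsSl2 n H D C₁)
include h

/-- The untwisted coproduct of `H` need not be primitive, but applying `a ↦ (e^{τ a} - 1) / τ` to it
gives a primitive, hence symmetric, element. Injectivity of this map carries the symmetry back. -/
lemma comm_conjExp_coprodH :
    Algebra.TensorProduct.comm ℝ⟦X⟧ A A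
      (conjExp (tau_pow_tensor h.tau_pow) (-(D ⊗ₜ H)) (coprodH H)) =
      conjExp (tau_pow_tensor h.tau_pow) (-(D ⊗ₜ H)) (coprodH H) := by
  apply expSubOneDivTrunc_injective (tau_pow_tensor h.tau_pow)
  have h1 : expSubOneDivTrunc n (conjExp (tau_pow_tensor h.tau_pow) (-(D ⊗ₜ H)) (coprodH H)) =
      prim (expSubOneDivTrunc n H) := by
    rw [← map_expSubOneDivTrunc, ← h.twist_prim_expSubOneDivTrunc, conjExp_neg_conjExp]
  have h2 := map_expSubOneDivTrunc (Algebra.TensorProduct.comm ℝ⟦X⟧ A A).toAlgHom n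
    (conjExp (tau_pow_tensor h.tau_pow) (-(D ⊗ₜ H)) (coprodH H))
  rw [h1] at h2
  exact h2.symm.trans ((comm_prim _).trans h1.symm)

/-- Writing `C₁ = (C₁ - τ D ^ 2) + τ D ^ 2`, the untwisted coproduct is a polynomial in two
primitive elements, which the flip fixes. -/
lemma comm_conjExp_coprodC₁ :
    Algebra.TensorProduct.comm ℝ⟦X⟧ A A
      (conjExp (tau_pow_tensor h.tau_pow) (-(D ⊗ₜ H)) (coprodD n H C₁)) =
      conjExp (tau_pow_tensor h.tau_pow) (-(D ⊗ₜ H)) (coprodD n H C₁) := by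
  have h1 : coprodD n H C₁ = conjExp (tau_pow_tensor h.tau_pow) (D ⊗ₜ H)
      (prim (C₁ - τ • D ^ 2) + τ • prim D ^ 2) := by
    rw [map_add, map_smul, map_pow, h.twist_prim_C₁, h.twist_prim_D, sub_add_cancel]
  rw [h1, conjExp_neg_conjExp, map_add, map_smul, map_pow, comm_prim, comm_prim]

/-- The hexagon identity for three commuting copies of `A`. -/
lemma expTrunc_hexagon {B : Type*} [Ring B] [Algebra ℝ⟦X⟧ B] (i j k : A →ₐ[ℝ⟦X⟧] B)
    (hij : ∀ a b, Commute (i a) (j b)) (hik : ∀ a b, Commute (i a) (k b))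
    (hjk : ∀ a b, Commute (j a) (k b)) :
    expTrunc n ((j D + i D * j (expTrunc n (-H))) * k H) * expTrunc n (-(j H * k D)) =
      expTrunc n (j D * k H) * expTrunc n (-(j H * k D)) * expTrunc n (i D * k H) := by
  have hn : algebraMap ℝ⟦X⟧ B (τ ^ n) = 0 := by
    rw [← j.commutes, h.tau_pow, map_zero]
  have hj : j (expTrunc n (-H)) = expTrunc n (-j H) := by rw [map_expTrunc, map_neg]
  have hk : k (expSubOneDivTrunc n H) = expSubOneDivTrunc n (k H) := map_expSubOneDivTrunc _ _ _
  rw [hj]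
  refine QuantumSO.expTrunc_hexagon hn (hij _ _) (hij _ _) (hik _ _) (hik _ _) (hjk _ _)
    (hjk _ _) (hjk _ _) ?_ ?_
  · rw [← hj, Ring.lie_def, ← map_mul, ← map_mul, ← map_sub, ← Ring.lie_def, h.lie_D_expTrunc_neg,
      map_add, map_neg, map_pow]
  · rw [← hk, Ring.lie_def, ← map_mul, ← map_mul, ← map_sub, ← Ring.lie_def,
      h.lie_D_expSubOneDivTrunc]

end IsSl2

section Legs

/-- `a ↦ a ⊗ 1 ⊗ 1`. -/
abbrev emb₁ : A →ₐ[ℝ⟦X⟧] T3 := Algebra.TensorProduct.includeLeft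

/-- `a ↦ 1 ⊗ a ⊗ 1`. -/
abbrev emb₂ : A →ₐ[ℝ⟦X⟧] T3 :=
  Algebra.TensorProduct.includeRight.comp Algebra.TensorProduct.includeLeft

/-- `a ↦ 1 ⊗ 1 ⊗ a`. -/
abbrev emb₃ : A →ₐ[ℝ⟦X⟧] T3 :=
  Algebra.TensorProduct.includeRight.comp Algebra.TensorProduct.includeRight

lemma commute_emb₁₂ (a b : A) : Commute (emb₁ a : T3) (emb₂ b) := by
  simp [Commute, SemiconjBy]

lemma commute_emb₁₃ (a b : A) : Commute (emb₁ a : T3) (emb₃ b) := by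
  simp [Commute, SemiconjBy]

lemma commute_emb₂₃ (a b : A) : Commute (emb₂ a : T3) (emb₃ b) := by
  simp [Commute, SemiconjBy]

variable (A) in
/-- `a ⊗ b ↦ a ⊗ b ⊗ 1`. -/
abbrev embLeg₁₂ : T2 →ₐ[ℝ⟦X⟧] T3 :=
  (Algebra.TensorProduct.assoc ℝ⟦X⟧ ℝ⟦X⟧ ℝ⟦X⟧ A A A).toAlgHom.comp
    Algebra.TensorProduct.includeLeft

variable (A) in
/-- `a ⊗ b ↦ a ⊗ 1 ⊗ b`. -/
abbrev embLeg₁₃ : T2 →ₐ[ℝ⟦X⟧] T3 :=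
  Algebra.TensorProduct.map (AlgHom.id _ _) Algebra.TensorProduct.includeRight

variable (A) in
/-- `a ⊗ b ↦ 1 ⊗ a ⊗ b`. -/
abbrev embLeg₂₃ : T2 →ₐ[ℝ⟦X⟧] T3 := Algebra.TensorProduct.includeRight

lemma embLeg₁₂_tmul (a b : A) : embLeg₁₂ A (a ⊗ₜ b) = emb₁ a * emb₂ b := by simp

lemma embLeg₁₃_tmul (a b : A) : embLeg₁₃ A (a ⊗ₜ b) = emb₁ a * emb₃ b := by simp

lemma embLeg₂₃_tmul (a b : A) : embLeg₂₃ A (a ⊗ₜ b) = emb₂ a * emb₃ b := by simp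

/-- `Δ ⊗ id` -/
abbrev comulIdLeft (Δ : A →ₐ[ℝ⟦X⟧] T2) : T2 →ₐ[ℝ⟦X⟧] T3 :=
  (Algebra.TensorProduct.assoc ℝ⟦X⟧ ℝ⟦X⟧ ℝ⟦X⟧ A A A).toAlgHom.comp
    (Algebra.TensorProduct.map Δ (AlgHom.id _ _))

/-- `id ⊗ Δ` -/
abbrev comulIdRight (Δ : A →ₐ[ℝ⟦X⟧] T2) : T2 →ₐ[ℝ⟦X⟧] T3 :=
  Algebra.TensorProduct.map (AlgHom.id _ _) Δ

lemma comulIdLeft_tmul (Δ : A →ₐ[ℝ⟦X⟧] T2) (a b : A) :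
    comulIdLeft Δ (a ⊗ₜ b) = embLeg₁₂ A (Δ a) * emb₃ b := by
  have h1 : (Δ a ⊗ₜ[ℝ⟦X⟧] b) = Δ a ⊗ₜ 1 * (1 ⊗ₜ 1) ⊗ₜ b := by
    rw [← Algebra.TensorProduct.one_def]; simp
  change (Algebra.TensorProduct.assoc ℝ⟦X⟧ ℝ⟦X⟧ ℝ⟦X⟧ A A A) (Δ a ⊗ₜ b) = _
  rw [h1, map_mul]
  rfl

lemma comulIdRight_tmul (Δ : A →ₐ[ℝ⟦X⟧] T2) (a b : A) :
    comulIdRight Δ (a ⊗ₜ b) = emb₁ a * embLeg₂₃ A (Δ b) := by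
  simp

end Legs

namespace IsSl2

variable {H D C₁ : A} (h : IsSl2 n H D C₁)
include h
lemma hexagon_left (Δ : A →ₐ[ℝ⟦X⟧] T2) (hH : Δ H = coprodH H) (hD : Δ D = coprodD n H D) :
    comulIdLeft Δ (rMatrixTrunc n H D) =
    embLeg₁₃ A (rMatrixTrunc n H D) * embLeg₂₃ A (rMatrixTrunc n H D) := by
  have hn : algebraMap ℝ⟦X⟧ T3 (τ ^ n) = 0 := by
    rw [← (emb₁ : A →ₐ[ℝ⟦X⟧] T3).commutes, h.tau_pow, map_zero]
  have key := h.expTrunc_hexagon (emb₁ : A →ₐ[ℝ⟦X⟧] T3) emb₂ emb₃ commute_emb₁₂ commute_emb₁₃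
    commute_emb₂₃
  have e1 : embLeg₁₂ A (coprodH H) = emb₁ H + emb₂ H := by
    rw [coprodH, map_add, embLeg₁₂_tmul, embLeg₁₂_tmul, map_one, map_one, one_mul, mul_one,
      add_comm]
  have e2 : embLeg₁₂ A (coprodD n H D) = emb₂ D + emb₁ D * emb₂ (expTrunc n (-H)) := by
    rw [coprodD, map_add, embLeg₁₂_tmul, embLeg₁₂_tmul, map_one, one_mul]
  rw [rMatrixTrunc]
  simp only [map_mul, map_expTrunc, map_neg]
  rw [comulIdLeft_tmul, comulIdLeft_tmul, embLeg₁₃_tmul, embLeg₁₃_tmul, embLeg₂₃_tmul,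
    embLeg₂₃_tmul, hH, hD, e1, e2, add_mul, expTrunc_add hn]
  swap
  · exact ((commute_emb₁₂ _ _).mul_right (commute_emb₁₃ _ _)).mul_left
      ((commute_emb₂₃ _ _).symm.mul_right (Commute.refl _))
  rw [mul_assoc, mul_assoc]
  congr 1
  rw [← mul_assoc]
  -- After cancelling `e^{τ H₁ D₃}`, the two sides are the inverses of the two sides of `key`.
  refine left_inv_eq_right_inv (a := expTrunc n ((emb₂ D + emb₁ D * emb₂ (expTrunc n (-H))) *
    emb₃ H) * expTrunc n (-(emb₂ H * emb₃ D))) ?_ ?_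
  · rw [mul_assoc, ← mul_assoc (expTrunc n (-_)), expTrunc_neg_mul hn, one_mul,
      expTrunc_mul_neg hn]
  · rw [key, mul_assoc, ← mul_assoc (expTrunc n (emb₁ D * emb₃ H)),
      ← mul_assoc (expTrunc n (emb₁ D * emb₃ H)),
      expTrunc_mul_neg hn, one_mul, mul_assoc, ← mul_assoc (expTrunc n (-_)), expTrunc_neg_mul hn,
      one_mul, expTrunc_mul_neg hn]

lemma hexagon_right (Δ : A →ₐ[ℝ⟦X⟧] T2) (hH : Δ H = coprodH H) (hD : Δ D = coprodD n H D) :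
    comulIdRight Δ (rMatrixTrunc n H D) =
    embLeg₁₃ A (rMatrixTrunc n H D) * embLeg₁₂ A (rMatrixTrunc n H D) := by
  have hn : algebraMap ℝ⟦X⟧ T3 (τ ^ n) = 0 := by
    rw [← (emb₁ : A →ₐ[ℝ⟦X⟧] T3).commutes, h.tau_pow, map_zero]
  -- The tensor factors are permuted cyclically. Here the identity is used as it stands, multiplied
  -- on the right by `e^{-τ D₁ H₂}`.
  have key := h.expTrunc_hexagon (emb₂ : A →ₐ[ℝ⟦X⟧] T3) emb₃ emb₁ commute_emb₂₃
    (fun a b => (commute_emb₁₂ b a).symm) (fun a b => (commute_emb₁₃ b a).symm)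
  have e1 : embLeg₂₃ A (coprodH H) = emb₂ H + emb₃ H := by
    rw [coprodH, map_add, embLeg₂₃_tmul, embLeg₂₃_tmul, map_one, map_one, one_mul, mul_one,
      add_comm]
  have e2 : embLeg₂₃ A (coprodD n H D) = emb₃ D + emb₂ D * emb₃ (expTrunc n (-H)) := by
    rw [coprodD, map_add, embLeg₂₃_tmul, embLeg₂₃_tmul, map_one, one_mul]
  rw [rMatrixTrunc]
  simp only [map_mul, map_expTrunc, map_neg]
  rw [comulIdRight_tmul, comulIdRight_tmul, embLeg₁₃_tmul, embLeg₁₃_tmul, embLeg₁₂_tmul,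
    embLeg₁₂_tmul, hH, hD, e1, e2]
  have hc : (emb₁ H : T3) * (emb₃ D + emb₂ D * emb₃ (expTrunc n (-H))) =
      (emb₃ D + emb₂ D * emb₃ (expTrunc n (-H))) * emb₁ H :=
    (commute_emb₁₃ _ _).add_right ((commute_emb₁₂ _ _).mul_right (commute_emb₁₃ _ _))
  have h1 : (emb₁ D : T3) * emb₂ H + emb₁ D * emb₃ H = emb₁ D * emb₃ H + emb₁ D * emb₂ H :=
    add_comm _ _
  rw [hc, mul_add, h1, neg_add, expTrunc_add hn, ← mul_assoc, (commute_emb₁₃ D H).eq, key,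
    (commute_emb₁₃ H D).eq, (commute_emb₁₂ H D).eq]
  · simp only [mul_assoc]
  · have c1 : Commute (emb₁ D : T3) (emb₁ D * emb₂ H) :=
      (Commute.refl _).mul_right (commute_emb₁₂ _ _)
    have c2 : Commute (emb₃ H : T3) (emb₁ D * emb₂ H) :=
      (commute_emb₁₃ _ _).symm.mul_right (commute_emb₂₃ _ _).symm
    exact (c1.mul_left c2).neg_left.neg_right

end IsSl2

end RMatrix

/-! ### Coassociativity on the generators other than `C₂`. -/

section Coassociativity

variable {A : Type*} [Ring A] [Algebra ℝ⟦X⟧ A] {n : ℕ}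

local notation "T2" => A ⊗[ℝ⟦X⟧] A

lemma coassoc_H (Δ : A →ₐ[ℝ⟦X⟧] T2) {H : A} (hH : Δ H = coprodH H) :
    comulIdLeft Δ (Δ H) = comulIdRight Δ (Δ H) := by
  rw [hH, coprodH, map_add, map_add, comulIdLeft_tmul, comulIdLeft_tmul, comulIdRight_tmul,
    comulIdRight_tmul, hH, coprodH]
  simp only [map_add, map_one, embLeg₁₂_tmul, embLeg₂₃_tmul, one_mul, mul_one]
  abel

lemma map_expTrunc_of_coprodH (hn : algebraMap ℝ⟦X⟧ A (τ ^ n) = 0) (Δ : A →ₐ[ℝ⟦X⟧] T2) {H : A}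
    (hH : Δ H = coprodH H) :
    Δ (expTrunc n H) = expTrunc n H ⊗ₜ[ℝ⟦X⟧] expTrunc n H := by
  rw [map_expTrunc, hH, expTrunc_coprodH hn]

lemma map_expTrunc_neg_of_coprodH (hn : algebraMap ℝ⟦X⟧ A (τ ^ n) = 0) (Δ : A →ₐ[ℝ⟦X⟧] T2) {H : A}
    (hH : Δ H = coprodH H) :
    Δ (expTrunc n (-H)) = expTrunc n (-H) ⊗ₜ[ℝ⟦X⟧] expTrunc n (-H) := by
  rw [map_expTrunc, map_neg, hH, neg_coprodH, expTrunc_coprodH hn]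

lemma coassoc_P (hn : algebraMap ℝ⟦X⟧ A (τ ^ n) = 0) (Δ : A →ₐ[ℝ⟦X⟧] T2) {H : A}
    (hH : Δ H = coprodH H) {P : A} (hP : Δ P = coprodP n H P) :
    comulIdLeft Δ (Δ P) = comulIdRight Δ (Δ P) := by
  rw [hP, coprodP, map_add, map_add, comulIdLeft_tmul, comulIdLeft_tmul, comulIdRight_tmul,
    comulIdRight_tmul, hP, map_expTrunc_of_coprodH hn Δ hH, coprodP]
  simp only [map_add, map_one, embLeg₁₂_tmul, embLeg₂₃_tmul, one_mul, add_mul, mul_assoc]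
  abel

lemma coassoc_D (hn : algebraMap ℝ⟦X⟧ A (τ ^ n) = 0) (Δ : A →ₐ[ℝ⟦X⟧] T2) {H : A}
    (hH : Δ H = coprodH H) {D : A} (hD : Δ D = coprodD n H D) :
    comulIdLeft Δ (Δ D) = comulIdRight Δ (Δ D) := by
  rw [hD, coprodD, map_add, map_add, comulIdLeft_tmul, comulIdLeft_tmul, comulIdRight_tmul,
    comulIdRight_tmul, hD, map_expTrunc_neg_of_coprodH hn Δ hH, coprodD]
  simp only [map_add, map_one, embLeg₁₂_tmul, embLeg₂₃_tmul, one_mul, add_mul, mul_assoc]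
  abel

lemma coassoc_K (hn : algebraMap ℝ⟦X⟧ A (τ ^ n) = 0) (Δ : A →ₐ[ℝ⟦X⟧] T2) {H : A}
    (hH : Δ H = coprodH H) {P K D : A} (hP : Δ P = coprodP n H P) (hD : Δ D = coprodD n H D)
    (hK : Δ K = coprodK n H P K D) :
    comulIdLeft Δ (Δ K) = comulIdRight Δ (Δ K) := by
  -- `e^{-τ H} P` is skew-primitive because the factor `e^{τ H}` in the coproduct of `P` cancels.
  have hfP : Δ (expTrunc n (-H) * P) = expTrunc n (-H) ⊗ₜ (expTrunc n (-H) * P) +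
      (expTrunc n (-H) * P) ⊗ₜ 1 := by
    rw [map_mul, map_expTrunc_neg_of_coprodH hn Δ hH, hP, coprodP, mul_add,
      Algebra.TensorProduct.tmul_mul_tmul, Algebra.TensorProduct.tmul_mul_tmul, mul_one,
      expTrunc_neg_mul hn]
  rw [hK, coprodK, map_sub, map_add, map_smul, map_sub, map_add, map_smul, comulIdLeft_tmul,
    comulIdLeft_tmul, comulIdLeft_tmul, comulIdRight_tmul, comulIdRight_tmul, comulIdRight_tmul, hK,
    hfP, hD, coprodD, coprodK]
  simp only [map_add, map_sub, map_smul, map_one, embLeg₁₂_tmul, embLeg₂₃_tmul, one_mul, mul_one,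
    add_mul, mul_add, mul_assoc, smul_add, map_mul]
  abel

end Coassociativity

/-! ### Compatibility of the coproduct formulas with homomorphisms and with the truncation order. -/

section Naturality

variable {A B : Type*} [Ring A] [Algebra ℝ⟦X⟧ A] [Ring B] [Algebra ℝ⟦X⟧ B] {n : ℕ}
  (f : A →ₐ[ℝ⟦X⟧] B) (H P K D C₂ : A)

lemma map_coprodH : Algebra.TensorProduct.map f f (coprodH H) = coprodH (f H) := by
  simp [coprodH]

lemma map_coprodP : Algebra.TensorProduct.map f f (coprodP n H P) = coprodP n (f H) (f P) := by
  simp [coprodP, map_expTrunc]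

lemma map_coprodD : Algebra.TensorProduct.map f f (coprodD n H D) = coprodD n (f H) (f D) := by
  simp [coprodD, map_expTrunc]

lemma map_coprodK : Algebra.TensorProduct.map f f (coprodK n H P K D) =
    coprodK n (f H) (f P) (f K) (f D) := by
  simp [coprodK, map_expTrunc]

lemma map_coprodC₂ : Algebra.TensorProduct.map f f (coprodC₂ n H P K D C₂) =
    coprodC₂ n (f H) (f P) (f K) (f D) (f C₂) := by
  simp [coprodC₂, map_expTrunc]

lemma map_rMatrixTrunc : Algebra.TensorProduct.map f f (rMatrixTrunc n H D) =
    rMatrixTrunc n (f H) (f D) := by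
  simp [rMatrixTrunc, map_expTrunc]

variable (hn : algebraMap ℝ⟦X⟧ A (τ ^ n) = 0)
include hn

lemma coprodP_succ : coprodP (n + 1) H P = coprodP n H P := by
  simp only [coprodP, expTrunc_succ hn]

lemma coprodD_succ : coprodD (n + 1) H D = coprodD n H D := by
  simp only [coprodD, expTrunc_succ hn]

lemma coprodK_succ : coprodK (n + 1) H P K D = coprodK n H P K D := by
  simp only [coprodK, expTrunc_succ hn]

lemma coprodC₂_succ : coprodC₂ (n + 1) H P K D C₂ = coprodC₂ n H P K D C₂ := by
  simp only [coprodC₂, expTrunc_succ hn]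

end Naturality

/-! ### The counit, which kills all generators. -/

section Counit

variable {A Q : Type*} [Ring A] [Algebra ℝ⟦X⟧ A] [CommRing Q] [Algebra ℝ⟦X⟧ Q] {n : ℕ}

lemma isSl2_zero (hn : algebraMap ℝ⟦X⟧ Q (τ ^ n) = 0) : IsSl2 n (0 : Q) 0 0 where
  tau_pow := hn
  DH := by simp [expSubOneDivTrunc_zero]
  DC₁ := by simp
  HC₁ := by simp

lemma isSo22_zero (hn : algebraMap ℝ⟦X⟧ Q (τ ^ n) = 0) : IsSo22 n (0 : Q) 0 0 0 0 0 :=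
  (isSl2_zero hn).isSo22 (by simp) (by simp [expSubOneDivTrunc_zero]) (by simp) (by simp)
    (by simp) (by simp) (by simp) (by simp) (by simp) (by simp) (by simp)

variable (hn : algebraMap ℝ⟦X⟧ Q (τ ^ n) = 0) (ε : A →ₐ[ℝ⟦X⟧] Q) {H P K D C₂ : A}

section Left

lemma map_counit_coprodH (hH : ε H = 0) :
    Algebra.TensorProduct.map ε (AlgHom.id ℝ⟦X⟧ A) (coprodH H) = 1 ⊗ₜ H := by
  simp [coprodH, hH]

lemma map_counit_coprodP (hP : ε P = 0) :
    Algebra.TensorProduct.map ε (AlgHom.id ℝ⟦X⟧ A) (coprodP n H P) = 1 ⊗ₜ P := by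
  simp [coprodP, hP]

lemma map_counit_coprodD (hD : ε D = 0) :
    Algebra.TensorProduct.map ε (AlgHom.id ℝ⟦X⟧ A) (coprodD n H D) = 1 ⊗ₜ D := by
  simp [coprodD, hD]

lemma map_counit_coprodK (hK : ε K = 0) (hD : ε D = 0) :
    Algebra.TensorProduct.map ε (AlgHom.id ℝ⟦X⟧ A) (coprodK n H P K D) = 1 ⊗ₜ K := by
  simp [coprodK, hK, hD]

lemma map_counit_coprodC₂ (hD : ε D = 0) (hC : ε C₂ = 0) :
    Algebra.TensorProduct.map ε (AlgHom.id ℝ⟦X⟧ A) (coprodC₂ n H P K D C₂) = 1 ⊗ₜ C₂ := by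
  simp [coprodC₂, hC, hD]

end Left

section Right

lemma map_coprodH_counit (hH : ε H = 0) :
    Algebra.TensorProduct.map (AlgHom.id ℝ⟦X⟧ A) ε (coprodH H) = H ⊗ₜ 1 := by
  simp [coprodH, hH]

lemma map_coprodK_counit (hP : ε P = 0) (hK : ε K = 0) :
    Algebra.TensorProduct.map (AlgHom.id ℝ⟦X⟧ A) ε (coprodK n H P K D) = K ⊗ₜ 1 := by
  simp [coprodK, hK, hP]

include hn

lemma map_coprodP_counit (hH : ε H = 0) (hP : ε P = 0) :
    Algebra.TensorProduct.map (AlgHom.id ℝ⟦X⟧ A) ε (coprodP n H P) = P ⊗ₜ 1 := by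
  simp [coprodP, hP, map_expTrunc, hH, expTrunc_zero hn]

lemma map_coprodD_counit (hH : ε H = 0) (hD : ε D = 0) :
    Algebra.TensorProduct.map (AlgHom.id ℝ⟦X⟧ A) ε (coprodD n H D) = D ⊗ₜ 1 := by
  simp [coprodD, hD, map_expTrunc, hH, expTrunc_zero hn]

lemma map_coprodC₂_counit (hH : ε H = 0) (hP : ε P = 0) (hK : ε K = 0) (hC : ε C₂ = 0) :
    Algebra.TensorProduct.map (AlgHom.id ℝ⟦X⟧ A) ε (coprodC₂ n H P K D C₂) = C₂ ⊗ₜ 1 := by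
  simp [coprodC₂, hC, hK, hP, map_expTrunc, hH, expTrunc_zero hn]

end Right

end Counit

/-- An element that is conjugate to a primitive one under the twist is intertwined by the
R-matrix. -/
lemma rMatrixTrunc_mul_of_prim {A : Type*} [Ring A] [Algebra ℝ⟦X⟧ A] {n : ℕ}
    (hn : algebraMap ℝ⟦X⟧ A (τ ^ n) = 0) {H D a : A} {d : A ⊗[ℝ⟦X⟧] A}
    (hd : conjExp (tau_pow_tensor hn) (D ⊗ₜ H) (prim a) = d) :
    rMatrixTrunc n H D * d = Algebra.TensorProduct.comm ℝ⟦X⟧ A A d * rMatrixTrunc n H D :=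
  rMatrixTrunc_mul hn H D d (by rw [← hd, conjExp_neg_conjExp, comm_prim])

/-! ### Passage from the reductions modulo `τ ^ n` to the inverse limit. -/

namespace Tower

variable {T : Tower}

lemma limit_ext {x y : T.limit} (h : ∀ n, x.1 n = y.1 n) : x = y := Subtype.ext (funext h)

lemma isUnit_expTau (a : T.limit) : IsUnit (T.expTau a) := by
  refine ⟨⟨T.expTau a, T.expTau (-a), ?_, ?_⟩, rfl⟩
  · exact limit_ext fun n => expTrunc_mul_neg (T.tau_pow n) (a.1 n)
  · exact limit_ext fun n => expTrunc_neg_mul (T.tau_pow n) (a.1 n)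

lemma isUnit_rMatrix (H D : T.limit) : IsUnit (rMatrix H D) :=
  (isUnit_expTau _).mul (isUnit_expTau _)

/-- A criterion for `rMatrix` to be a universal R-matrix in terms of the reductions
modulo `τ ^ n`. -/
lemma isUniversalRMatrix_of_forall (Δ : Hom T (T.tensor T)) (H D : T.limit)
    (C : ∀ n, T.obj n) (h : ∀ n, IsSl2 n (H.1 n) (D.1 n) (C n))
    (hH : ∀ n, Δ.app n (H.1 n) = coprodH (H.1 n))
    (hD : ∀ n, Δ.app n (D.1 n) = coprodD n (H.1 n) (D.1 n))
    (hR : ∀ n (x : T.obj n), rMatrixTrunc n (H.1 n) (D.1 n) * Δ.app n x =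
      Algebra.TensorProduct.comm ℝ⟦X⟧ (T.obj n) (T.obj n) (Δ.app n x) *
        rMatrixTrunc n (H.1 n) (D.1 n)) :
    IsUniversalRMatrix Δ (rMatrix H D) where
  isUnit := isUnit_rMatrix H D
  intertwines x := limit_ext fun n => hR n (x.1 n)
  hexagon_left := limit_ext fun n => (h n).hexagon_left (Δ.app n) (hH n) (hD n)
  hexagon_right := limit_ext fun n => (h n).hexagon_right (Δ.app n) (hH n) (hD n)

end Tower

/-- An invertible element that intertwines two homomorphisms on generators intertwines them on the
whole algebra. -/
lemma intertwines_of_conj {A B : Type*} [Ring A] [Algebra ℝ⟦X⟧ A] [Ring B] [Algebra ℝ⟦X⟧ B]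
    {R : B} (hR : IsUnit R) {f g : A →ₐ[ℝ⟦X⟧] B} {ι : Type*} (gen : ι → A)
    (hext : ∀ f g : A →ₐ[ℝ⟦X⟧] B, (∀ i, f (gen i) = g (gen i)) → f = g)
    (h : ∀ i, R * f (gen i) = g (gen i) * R) (x : A) : R * f x = g x * R := by
  obtain ⟨u, rfl⟩ := hR
  let c : A →ₐ[ℝ⟦X⟧] B :=
    { toFun x := u * f x * (u⁻¹ : Bˣ)
      map_one' := by simp
      map_mul' x y := by simp [mul_assoc]
      map_zero' := by simp
      map_add' x y := by simp [mul_add, add_mul]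
      commutes' r := by simp [← Algebra.commutes r (u : B), mul_assoc] }
  have hc : c = g := hext c g fun i => by
    change (u : B) * f (gen i) * (u⁻¹ : Bˣ) = _
    rw [h, mul_assoc, Units.mul_inv, mul_one]
  rw [← hc]
  change _ = (u : B) * f x * (u⁻¹ : Bˣ) * u
  rw [mul_assoc, Units.inv_mul, mul_one]

lemma isUnit_rMatrixTrunc {A : Type*} [Ring A] [Algebra ℝ⟦X⟧ A] {n : ℕ}
    (hn : algebraMap ℝ⟦X⟧ A (τ ^ n) = 0) (H D : A) : IsUnit (rMatrixTrunc n H D) :=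
  have h (a : A ⊗[ℝ⟦X⟧] A) : IsUnit (expTrunc n a) :=
    ⟨⟨_, _, expTrunc_mul_neg (tau_pow_tensor hn) a, expTrunc_neg_mul (tau_pow_tensor hn) a⟩, rfl⟩
  (h _).mul (h _)

/-! ### The bialgebra `U_τ(sl(2,ℝ))` and its R-matrix. -/

namespace Sl2

open Sl2Gen

lemma isSl2_gen (n : ℕ) : IsSl2 n (gen n H) (gen n D) (gen n C₁) where
  tau_pow := tau_pow n
  DH := by simpa [Ring.lie_def, two_mul, map_expSubOneDivTrunc, gen] using mk_rel (Rel.DH (n := n))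
  DC₁ := by simpa [Ring.lie_def, two_mul, gen] using mk_rel (Rel.DC₁ (n := n))
  HC₁ := by simpa [Ring.lie_def, two_mul, gen] using mk_rel (Rel.HC₁ (n := n))

section Lift

variable {n : ℕ} {B : Type*} [Ring B] [Algebra ℝ⟦X⟧ B]

/-- The homomorphism with given values on the generators. -/
def homOf (v : Sl2Gen → B) (h : IsSl2 n (v H) (v D) (v C₁)) : Level n →ₐ[ℝ⟦X⟧] B :=
  lift n (FreeAlgebra.lift ℝ⟦X⟧ v) fun x y hxy => by
    cases hxy with
    | tau_pow => simpa using h.tau_pow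
    | DH => simpa [Ring.lie_def, two_mul, map_expSubOneDivTrunc] using h.DH
    | DC₁ => simpa [Ring.lie_def, two_mul] using h.DC₁
    | HC₁ => simpa [Ring.lie_def, two_mul] using h.HC₁

lemma homOf_gen (v : Sl2Gen → B) (h : IsSl2 n (v H) (v D) (v C₁)) (g : Sl2Gen) :
    homOf v h (gen n g) = v g := by
  rw [homOf, gen, lift_mk, FreeAlgebra.lift_ι_apply]

lemma hom_ext {f f' : Level n →ₐ[ℝ⟦X⟧] B} (h : ∀ g, f (gen n g) = f' (gen n g)) : f = f' := by
  have : f.comp (mk n) = f'.comp (mk n) := FreeAlgebra.hom_ext (funext h)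
  exact RingQuot.ringQuot_ext' ℝ⟦X⟧ f f' this

end Lift

lemma proj_gen (n : ℕ) (g : Sl2Gen) : U.proj n (gen (n + 1) g) = gen n g := (x g).2 n

/-- The coproduct of the generators modulo `τ ^ n`. -/
def coprodGen (n : ℕ) : Sl2Gen → Level n ⊗[ℝ⟦X⟧] Level n
  | H => coprodH (gen n H)
  | D => coprodD n (gen n H) (gen n D)
  | C₁ => coprodD n (gen n H) (gen n C₁)

/-- The coproduct modulo `τ ^ n`. -/
def comul (n : ℕ) : Level n →ₐ[ℝ⟦X⟧] Level n ⊗[ℝ⟦X⟧] Level n :=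
  homOf (coprodGen n) (isSl2_gen n).coproduct

lemma comul_gen (n : ℕ) (g : Sl2Gen) : comul n (gen n g) = coprodGen n g := homOf_gen _ _ g

/-- The coproduct of `U_τ(sl(2,ℝ))`. -/
def coproduct : U.Hom (U.tensor U) where
  app := comul
  comm n := by
    refine hom_ext fun g => ?_
    change Algebra.TensorProduct.map (U.proj n) (U.proj n) (comul (n + 1) (gen (n + 1) g)) =
      comul n (U.proj n (gen (n + 1) g))
    rw [proj_gen, comul_gen, comul_gen]
    have h := tau_pow n
    cases g
    · exact (map_coprodH _ _).trans (by rw [proj_gen]; rfl)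
    · exact (map_coprodD _ _ _).trans (by rw [proj_gen, proj_gen]; exact coprodD_succ _ _ h)
    · exact (map_coprodD _ _ _).trans (by rw [proj_gen, proj_gen]; exact coprodD_succ _ _ h)

/-- The counit modulo `τ ^ n`. -/
def counitLevel (n : ℕ) : Level n →ₐ[ℝ⟦X⟧] Tower.ground.obj n :=
  homOf (fun _ => 0) (isSl2_zero (Tower.ground.tau_pow n))

lemma counitLevel_gen (n : ℕ) (g : Sl2Gen) : counitLevel n (gen n g) = 0 := homOf_gen _ _ g

/-- The counit of `U_τ(sl(2,ℝ))`. -/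
def counit : U.Hom Tower.ground where
  app := counitLevel
  comm n := hom_ext fun g => by
    change Tower.ground.proj n (counitLevel (n + 1) (gen (n + 1) g)) =
      counitLevel n (U.proj n (gen (n + 1) g))
    rw [proj_gen, counitLevel_gen, counitLevel_gen, map_zero]

lemma isCoproduct : IsCoproduct coproduct where
  val_H := Tower.limit_ext fun n => comul_gen n H
  val_D := Tower.limit_ext fun n => comul_gen n D
  val_C₁ := Tower.limit_ext fun n => comul_gen n C₁

lemma isBialgebra : Tower.IsBialgebra coproduct counit where
  coassoc x := Tower.limit_ext fun n => by
    have h : (comulIdLeft (comul n)).comp (comul n) = (comulIdRight (comul n)).comp (comul n) := by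
      refine hom_ext fun g => ?_
      have h := tau_pow n
      have hH := comul_gen n H
      cases g
      · exact coassoc_H _ hH
      · exact coassoc_D h _ hH (comul_gen n D)
      · exact coassoc_D h _ hH (comul_gen n C₁)
    exact DFunLike.congr_fun h (x.1 n)
  counit_left x := Tower.limit_ext fun n => by
    have h : (Algebra.TensorProduct.map (counitLevel n) (AlgHom.id ℝ⟦X⟧ (Level n))).comp (comul n) =
        Algebra.TensorProduct.includeRight := by
      refine hom_ext fun g => ?_
      rw [AlgHom.comp_apply, comul_gen]
      cases g
      · exact map_counit_coprodH _ (counitLevel_gen n H)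
      · exact map_counit_coprodD _ (counitLevel_gen n D)
      · exact map_counit_coprodD _ (counitLevel_gen n C₁)
    exact DFunLike.congr_fun h (x.1 n)
  counit_right x := Tower.limit_ext fun n => by
    have h : (Algebra.TensorProduct.map (AlgHom.id ℝ⟦X⟧ (Level n)) (counitLevel n)).comp (comul n) =
        Algebra.TensorProduct.includeLeft := by
      refine hom_ext fun g => ?_
      rw [AlgHom.comp_apply, comul_gen]
      have hn := Tower.ground.tau_pow n
      have hH := counitLevel_gen n H
      cases g
      · exact map_coprodH_counit _ hH
      · exact map_coprodD_counit hn _ hH (counitLevel_gen n D)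
      · exact map_coprodD_counit hn _ hH (counitLevel_gen n C₁)
    exact DFunLike.congr_fun h (x.1 n)

lemma isUniversalRMatrix : Tower.IsUniversalRMatrix coproduct (Tower.rMatrix (x H) (x D)) := by
  refine Tower.isUniversalRMatrix_of_forall coproduct _ _ (fun n => gen n C₁) isSl2_gen
    (fun n => comul_gen n H) (fun n => comul_gen n D) fun n => ?_
  have h := isSl2_gen n
  refine intertwines_of_conj (isUnit_rMatrixTrunc h.tau_pow _ _) (f := comul n)
    (g := (Algebra.TensorProduct.comm ℝ⟦X⟧ (Level n) (Level n)).toAlgHom.comp (comul n))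
    (gen n) (fun _ _ => hom_ext) fun g => ?_
  rw [AlgHom.comp_apply, comul_gen]
  cases g
  · exact rMatrixTrunc_mul h.tau_pow _ _ _ h.comm_conjExp_coprodH
  · exact rMatrixTrunc_mul_of_prim h.tau_pow h.twist_prim_D
  · exact rMatrixTrunc_mul h.tau_pow _ _ _ h.comm_conjExp_coprodC₁

end Sl2

/-! ### The bialgebra `U_τ(so(2,2))`, its R-matrix and the map from `U_τ(sl(2,ℝ))`. -/

namespace So22

open So22Gen

lemma isSo22_gen (n : ℕ) :
    IsSo22 n (gen n H) (gen n P) (gen n K) (gen n D) (gen n C₁) (gen n C₂) where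
  tau_pow := tau_pow n
  KH := by simpa [Ring.lie_def, two_mul, map_expTrunc, gen] using mk_rel (Rel.KH (n := n))
  KP := by simpa [Ring.lie_def, two_mul, map_expSubOneDivTrunc, gen] using mk_rel (Rel.KP (n := n))
  HP := by simpa [Ring.lie_def, two_mul, gen] using mk_rel (Rel.HP (n := n))
  DH := by simpa [Ring.lie_def, two_mul, map_expSubOneDivTrunc, gen] using mk_rel (Rel.DH (n := n))
  DC₁ := by simpa [Ring.lie_def, two_mul, gen] using mk_rel (Rel.DC₁ (n := n))
  HC₁ := by simpa [Ring.lie_def, two_mul, gen] using mk_rel (Rel.HC₁ (n := n))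
  DP := by simpa [Ring.lie_def, two_mul, gen] using mk_rel (Rel.DP (n := n))
  DC₂ := by simpa [Ring.lie_def, two_mul, gen] using mk_rel (Rel.DC₂ (n := n))
  PC₂ := by simpa [Ring.lie_def, two_mul, gen] using mk_rel (Rel.PC₂ (n := n))
  KC₁ := by simpa [Ring.lie_def, two_mul, gen] using mk_rel (Rel.KC₁ (n := n))
  KC₂ := by simpa [Ring.lie_def, two_mul, gen] using mk_rel (Rel.KC₂ (n := n))
  C₁C₂ := by simpa [Ring.lie_def, two_mul, gen] using mk_rel (Rel.C₁C₂ (n := n))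
  HC₂ := by simpa [Ring.lie_def, two_mul, map_expTrunc, gen] using mk_rel (Rel.HC₂ (n := n))
  PC₁ := by simpa [Ring.lie_def, two_mul, gen] using mk_rel (Rel.PC₁ (n := n))
  KD := by simpa [Ring.lie_def, two_mul, gen] using mk_rel (Rel.KD (n := n))

section Lift

variable {n : ℕ} {B : Type*} [Ring B] [Algebra ℝ⟦X⟧ B]

/-- The homomorphism with given values on the generators. -/
def homOf (v : So22Gen → B) (h : IsSo22 n (v H) (v P) (v K) (v D) (v C₁) (v C₂)) :
    Level n →ₐ[ℝ⟦X⟧] B :=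
  lift n (FreeAlgebra.lift ℝ⟦X⟧ v) fun x y hxy => by
    cases hxy with
    | tau_pow => simpa using h.tau_pow
    | KH => simpa [Ring.lie_def, two_mul, map_expTrunc] using h.KH
    | KP => simpa [Ring.lie_def, two_mul, map_expSubOneDivTrunc] using h.KP
    | HP => simpa [Ring.lie_def, two_mul] using h.HP
    | DH => simpa [Ring.lie_def, two_mul, map_expSubOneDivTrunc] using h.DH
    | DC₁ => simpa [Ring.lie_def, two_mul] using h.DC₁
    | HC₁ => simpa [Ring.lie_def, two_mul] using h.HC₁
    | DP => simpa [Ring.lie_def, two_mul] using h.DP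
    | DC₂ => simpa [Ring.lie_def, two_mul] using h.DC₂
    | PC₂ => simpa [Ring.lie_def, two_mul] using h.PC₂
    | KC₁ => simpa [Ring.lie_def, two_mul] using h.KC₁
    | KC₂ => simpa [Ring.lie_def, two_mul] using h.KC₂
    | C₁C₂ => simpa [Ring.lie_def, two_mul] using h.C₁C₂
    | HC₂ => simpa [Ring.lie_def, two_mul, map_expTrunc] using h.HC₂
    | PC₁ => simpa [Ring.lie_def, two_mul] using h.PC₁
    | KD => simpa [Ring.lie_def, two_mul] using h.KD

lemma homOf_gen (v : So22Gen → B) (h : IsSo22 n (v H) (v P) (v K) (v D) (v C₁) (v C₂))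
    (g : So22Gen) : homOf v h (gen n g) = v g := by
  rw [homOf, gen, lift_mk, FreeAlgebra.lift_ι_apply]

lemma hom_ext {f f' : Level n →ₐ[ℝ⟦X⟧] B} (h : ∀ g, f (gen n g) = f' (gen n g)) : f = f' := by
  have : f.comp (mk n) = f'.comp (mk n) := FreeAlgebra.hom_ext (funext h)
  exact RingQuot.ringQuot_ext' ℝ⟦X⟧ f f' this

end Lift

lemma proj_gen (n : ℕ) (g : So22Gen) : U.proj n (gen (n + 1) g) = gen n g := (x g).2 n

/-- The coproduct of the generators modulo `τ ^ n`. -/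
def coprodGen (n : ℕ) : So22Gen → Level n ⊗[ℝ⟦X⟧] Level n
  | H => coprodH (gen n H)
  | P => coprodP n (gen n H) (gen n P)
  | K => coprodK n (gen n H) (gen n P) (gen n K) (gen n D)
  | D => coprodD n (gen n H) (gen n D)
  | C₁ => coprodD n (gen n H) (gen n C₁)
  | C₂ => coprodC₂ n (gen n H) (gen n P) (gen n K) (gen n D) (gen n C₂)

/-- The coproduct modulo `τ ^ n`. -/
def comul (n : ℕ) : Level n →ₐ[ℝ⟦X⟧] Level n ⊗[ℝ⟦X⟧] Level n :=
  homOf (coprodGen n) (isSo22_gen n).coproduct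

lemma comul_gen (n : ℕ) (g : So22Gen) : comul n (gen n g) = coprodGen n g := homOf_gen _ _ g

/-- The coproduct of `U_τ(so(2,2))`. -/
def coproduct : U.Hom (U.tensor U) where
  app := comul
  comm n := by
    refine hom_ext fun g => ?_
    change Algebra.TensorProduct.map (U.proj n) (U.proj n) (comul (n + 1) (gen (n + 1) g)) =
      comul n (U.proj n (gen (n + 1) g))
    rw [proj_gen, comul_gen, comul_gen]
    have h := tau_pow n
    cases g
    · exact (map_coprodH _ _).trans (by simp only [proj_gen]; rfl)
    · exact (map_coprodP _ _ _).trans (by simp only [proj_gen]; exact coprodP_succ _ _ h)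
    · exact (map_coprodK _ _ _ _ _).trans (by simp only [proj_gen]; exact coprodK_succ _ _ _ _ h)
    · exact (map_coprodD _ _ _).trans (by simp only [proj_gen]; exact coprodD_succ _ _ h)
    · exact (map_coprodD _ _ _).trans (by simp only [proj_gen]; exact coprodD_succ _ _ h)
    · exact (map_coprodC₂ _ _ _ _ _ _).trans
        (by simp only [proj_gen]; exact coprodC₂_succ _ _ _ _ _ h)

/-- The counit modulo `τ ^ n`. -/
def counitLevel (n : ℕ) : Level n →ₐ[ℝ⟦X⟧] Tower.ground.obj n :=
  homOf (fun _ => 0) (isSo22_zero (Tower.ground.tau_pow n))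

lemma counitLevel_gen (n : ℕ) (g : So22Gen) : counitLevel n (gen n g) = 0 := homOf_gen _ _ g

/-- The counit of `U_τ(so(2,2))`. -/
def counit : U.Hom Tower.ground where
  app := counitLevel
  comm n := hom_ext fun g => by
    change Tower.ground.proj n (counitLevel (n + 1) (gen (n + 1) g)) =
      counitLevel n (U.proj n (gen (n + 1) g))
    rw [proj_gen, counitLevel_gen, counitLevel_gen, map_zero]

lemma isCoproduct : IsCoproduct coproduct where
  val_H := Tower.limit_ext fun n => comul_gen n H
  val_P := Tower.limit_ext fun n => (comul_gen n P).trans (by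
    change _ = (1 : Level n) ⊗ₜ[ℝ⟦X⟧] gen n P + gen n P ⊗ₜ[ℝ⟦X⟧] expTrunc n ((1 : ℤ) • gen n H)
    rw [one_smul]; rfl)
  val_D := Tower.limit_ext fun n => (comul_gen n D).trans (by
    change _ = (1 : Level n) ⊗ₜ[ℝ⟦X⟧] gen n D + gen n D ⊗ₜ[ℝ⟦X⟧] expTrunc n ((-1 : ℤ) • gen n H)
    rw [neg_one_smul]; rfl)
  val_C₁ := Tower.limit_ext fun n => (comul_gen n C₁).trans (by
    change _ = (1 : Level n) ⊗ₜ[ℝ⟦X⟧] gen n C₁ + gen n C₁ ⊗ₜ[ℝ⟦X⟧] expTrunc n ((-1 : ℤ) • gen n H)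
    rw [neg_one_smul]; rfl)
  val_K := Tower.limit_ext fun n => (comul_gen n K).trans (by
    change _ = (1 : Level n) ⊗ₜ[ℝ⟦X⟧] gen n K + gen n K ⊗ₜ[ℝ⟦X⟧] (1 : Level n)
      - τ • gen n D ⊗ₜ[ℝ⟦X⟧] (expTrunc n ((-1 : ℤ) • gen n H) * gen n P)
    rw [neg_one_smul]; rfl)
  val_C₂ := Tower.limit_ext fun n => (comul_gen n C₂).trans (by
    change _ = (1 : Level n) ⊗ₜ[ℝ⟦X⟧] gen n C₂ + gen n C₂ ⊗ₜ[ℝ⟦X⟧] expTrunc n ((-1 : ℤ) • gen n H)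
      + (2 * τ) • gen n D ⊗ₜ[ℝ⟦X⟧] (expTrunc n ((-1 : ℤ) • gen n H) * gen n K)
      - τ ^ 2 • (gen n D * (gen n D + 1)) ⊗ₜ[ℝ⟦X⟧] (expTrunc n ((-2 : ℤ) • gen n H) * gen n P)
    have h2 : expTrunc n ((-2 : ℤ) • gen n H) = expTrunc n (-gen n H) ^ 2 := by
      rw [pow_two, ← expTrunc_add (tau_pow n) (Commute.refl _)]
      congr 1
      module
    rw [h2, neg_one_smul]; rfl)

lemma isBialgebra : Tower.IsBialgebra coproduct counit where
  coassoc x := Tower.limit_ext fun n => by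
    have h : (comulIdLeft (comul n)).comp (comul n) = (comulIdRight (comul n)).comp (comul n) := by
      have hn := tau_pow n
      have hH := comul_gen n H
      have hC₁ := coassoc_D hn _ hH (comul_gen n C₁)
      have hK := coassoc_K hn _ hH (comul_gen n P) (comul_gen n D) (comul_gen n K)
      refine hom_ext fun g => ?_
      cases g
      · exact coassoc_H _ hH
      · exact coassoc_P hn _ hH (comul_gen n P)
      · exact hK
      · exact coassoc_D hn _ hH (comul_gen n D)
      · exact hC₁
      -- Since `C₂ = [K, C₁]` and both sides are homomorphisms, coassociativity on `C₂` follows from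
      -- that on `K` and `C₁`.
      · simp only [← (isSo22_gen n).KC₁, Ring.lie_def, map_sub, map_mul, AlgHom.comp_apply, hK, hC₁]
    exact DFunLike.congr_fun h (x.1 n)
  counit_left x := Tower.limit_ext fun n => by
    have h : (Algebra.TensorProduct.map (counitLevel n) (AlgHom.id ℝ⟦X⟧ (Level n))).comp (comul n) =
        Algebra.TensorProduct.includeRight := by
      refine hom_ext fun g => ?_
      rw [AlgHom.comp_apply, comul_gen]
      cases g
      · exact map_counit_coprodH _ (counitLevel_gen n H)
      · exact map_counit_coprodP _ (counitLevel_gen n P)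
      · exact map_counit_coprodK _ (counitLevel_gen n K) (counitLevel_gen n D)
      · exact map_counit_coprodD _ (counitLevel_gen n D)
      · exact map_counit_coprodD _ (counitLevel_gen n C₁)
      · exact map_counit_coprodC₂ _ (counitLevel_gen n D) (counitLevel_gen n C₂)
    exact DFunLike.congr_fun h (x.1 n)
  counit_right x := Tower.limit_ext fun n => by
    have h : (Algebra.TensorProduct.map (AlgHom.id ℝ⟦X⟧ (Level n)) (counitLevel n)).comp (comul n) =
        Algebra.TensorProduct.includeLeft := by
      refine hom_ext fun g => ?_
      rw [AlgHom.comp_apply, comul_gen]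
      have hn := Tower.ground.tau_pow n
      have hH := counitLevel_gen n H
      cases g
      · exact map_coprodH_counit _ hH
      · exact map_coprodP_counit hn _ hH (counitLevel_gen n P)
      · exact map_coprodK_counit _ (counitLevel_gen n P) (counitLevel_gen n K)
      · exact map_coprodD_counit hn _ hH (counitLevel_gen n D)
      · exact map_coprodD_counit hn _ hH (counitLevel_gen n C₁)
      · exact map_coprodC₂_counit hn _ hH (counitLevel_gen n P) (counitLevel_gen n K)
          (counitLevel_gen n C₂)
    exact DFunLike.congr_fun h (x.1 n)

/-- The hexagons need only the relations of the `sl(2,ℝ)` part. The larger algebra enters through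
the intertwining property on `P`, `K`, `C₂`, whose coproducts are twisted primitive elements. -/
lemma isUniversalRMatrix : Tower.IsUniversalRMatrix coproduct (Tower.rMatrix (x H) (x D)) := by
  refine Tower.isUniversalRMatrix_of_forall coproduct _ _ (fun n => gen n C₁)
    (fun n => (isSo22_gen n).toIsSl2) (fun n => comul_gen n H) (fun n => comul_gen n D) fun n => ?_
  have h := isSo22_gen n
  refine intertwines_of_conj (isUnit_rMatrixTrunc h.tau_pow _ _) (f := comul n)
    (g := (Algebra.TensorProduct.comm ℝ⟦X⟧ (Level n) (Level n)).toAlgHom.comp (comul n))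
    (gen n) (fun _ _ => hom_ext) fun g => ?_
  rw [AlgHom.comp_apply, comul_gen]
  cases g
  · exact rMatrixTrunc_mul h.tau_pow _ _ _ h.comm_conjExp_coprodH
  · exact rMatrixTrunc_mul_of_prim h.tau_pow h.twist_prim_P
  · exact rMatrixTrunc_mul_of_prim h.tau_pow h.twist_prim_K
  · exact rMatrixTrunc_mul_of_prim h.tau_pow h.twist_prim_D
  · exact rMatrixTrunc_mul h.tau_pow _ _ _ h.comm_conjExp_coprodC₁
  · exact rMatrixTrunc_mul_of_prim h.tau_pow h.twist_prim_C₂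

/-- The values of the canonical map `U_τ(sl(2,ℝ)) → U_τ(so(2,2))` on the generators. -/
def ofSl2Gen : Sl2Gen → So22Gen
  | .H => H
  | .D => D
  | .C₁ => C₁

/-- The canonical map `U_τ(sl(2,ℝ)) → U_τ(so(2,2))` modulo `τ ^ n`. -/
def ofSl2Level (n : ℕ) : Sl2.Level n →ₐ[ℝ⟦X⟧] Level n :=
  Sl2.homOf (fun g => gen n (ofSl2Gen g)) (isSo22_gen n).toIsSl2

lemma ofSl2Level_gen (n : ℕ) (g : Sl2Gen) : ofSl2Level n (Sl2.gen n g) = gen n (ofSl2Gen g) :=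
  Sl2.homOf_gen _ _ g

/-- The canonical map `U_τ(sl(2,ℝ)) → U_τ(so(2,2))`. -/
def ofSl2 : Sl2.U.Hom U where
  app := ofSl2Level
  comm n := Sl2.hom_ext fun g => by
    change U.proj n (ofSl2Level (n + 1) (Sl2.gen (n + 1) g)) =
      ofSl2Level n (Sl2.U.proj n (Sl2.gen (n + 1) g))
    rw [Sl2.proj_gen, ofSl2Level_gen, ofSl2Level_gen, proj_gen]

lemma ofSl2_x (g : Sl2Gen) : ofSl2.lim (Sl2.x g) = x (ofSl2Gen g) :=
  Tower.limit_ext fun n => ofSl2Level_gen n g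

lemma coproduct_ofSl2 (a : Sl2.U.limit) :
    coproduct.lim (ofSl2.lim a) = (ofSl2.tensor ofSl2).lim (Sl2.coproduct.lim a) :=
  Tower.limit_ext fun n => by
    have h : (comul n).comp (ofSl2Level n) =
        (Algebra.TensorProduct.map (ofSl2Level n) (ofSl2Level n)).comp (Sl2.comul n) := by
      refine Sl2.hom_ext fun g => ?_
      rw [AlgHom.comp_apply, AlgHom.comp_apply, Sl2.comul_gen, ofSl2Level_gen, comul_gen]
      cases g <;>
        simp only [Sl2.coprodGen, map_coprodH, map_coprodD, ofSl2Level_gen] <;> rfl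
    exact DFunLike.congr_fun h (a.1 n)

lemma counit_ofSl2 (a : Sl2.U.limit) : counit.lim (ofSl2.lim a) = Sl2.counit.lim a :=
  Tower.limit_ext fun n => by
    have h : (counitLevel n).comp (ofSl2Level n) = Sl2.counitLevel n := Sl2.hom_ext fun g => by
      rw [AlgHom.comp_apply, ofSl2Level_gen]
      exact (counitLevel_gen n _).trans (Sl2.counitLevel_gen n g).symm
    exact DFunLike.congr_fun h (a.1 n)

lemma ofSl2_rMatrix : (ofSl2.tensor ofSl2).lim (Tower.rMatrix (Sl2.x .H) (Sl2.x .D)) =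
    Tower.rMatrix (x H) (x D) :=
  Tower.limit_ext fun n => (map_rMatrixTrunc (ofSl2Level n) (Sl2.gen n .H) (Sl2.gen n .D)).trans (by
    rw [ofSl2Level_gen, ofSl2Level_gen]; rfl)

end So22

end QuantumSO

end

theorem mainTheorem2 :
    ∃ (Δ₀ : QuantumSO.Sl2.U.Hom (QuantumSO.Sl2.U.tensor QuantumSO.Sl2.U))
      (ε₀ : QuantumSO.Sl2.U.Hom QuantumSO.Tower.ground)
      (Δ : QuantumSO.So22.U.Hom (QuantumSO.So22.U.tensor QuantumSO.So22.U))
      (ε : QuantumSO.So22.U.Hom QuantumSO.Tower.ground)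
      (j : QuantumSO.Sl2.U.Hom QuantumSO.So22.U),
      -- `U_τ(sl(2,ℝ))` is a bialgebra with universal R-matrix `exp{τ H ⊗ D} exp{-τ D ⊗ H}`
      QuantumSO.Sl2.IsCoproduct Δ₀ ∧ QuantumSO.Tower.IsBialgebra Δ₀ ε₀ ∧
      QuantumSO.Tower.IsUniversalRMatrix Δ₀
        (QuantumSO.Tower.rMatrix (QuantumSO.Sl2.x .H) (QuantumSO.Sl2.x .D)) ∧
      -- `U_τ(so(2,2))` is a bialgebra
      QuantumSO.So22.IsCoproduct Δ ∧ QuantumSO.Tower.IsBialgebra Δ ε ∧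
      -- the canonical bialgebra map `j` from the former to the latter carries the R-matrix of
      -- `U_τ(sl(2,ℝ))` to the element of the same form
      j.lim (QuantumSO.Sl2.x .H) = QuantumSO.So22.x .H ∧
      j.lim (QuantumSO.Sl2.x .D) = QuantumSO.So22.x .D ∧
      j.lim (QuantumSO.Sl2.x .C₁) = QuantumSO.So22.x .C₁ ∧
      (∀ a, Δ.lim (j.lim a) = (j.tensor j).lim (Δ₀.lim a)) ∧
      (∀ a, ε.lim (j.lim a) = ε₀.lim a) ∧
      (j.tensor j).lim
          (QuantumSO.Tower.rMatrix (QuantumSO.Sl2.x .H) (QuantumSO.Sl2.x .D)) =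
        QuantumSO.Tower.rMatrix (QuantumSO.So22.x .H) (QuantumSO.So22.x .D) ∧
      -- and that element is a universal R-matrix for the whole `U_τ(so(2,2))`
      QuantumSO.Tower.IsUniversalRMatrix Δ
        (QuantumSO.Tower.rMatrix (QuantumSO.So22.x .H) (QuantumSO.So22.x .D)) :=
  ⟨QuantumSO.Sl2.coproduct, QuantumSO.Sl2.counit, QuantumSO.So22.coproduct, QuantumSO.So22.counit,
    QuantumSO.So22.ofSl2, QuantumSO.Sl2.isCoproduct, QuantumSO.Sl2.isBialgebra,
    QuantumSO.Sl2.isUniversalRMatrix, QuantumSO.So22.isCoproduct, QuantumSO.So22.isBialgebra,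
    QuantumSO.So22.ofSl2_x .H, QuantumSO.So22.ofSl2_x .D, QuantumSO.So22.ofSl2_x .C₁,
    QuantumSO.So22.coproduct_ofSl2, QuantumSO.So22.counit_ofSl2, QuantumSO.So22.ofSl2_rMatrix,
    QuantumSO.So22.isUniversalRMatrix⟩
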